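/- Let $(M,g)$ be a smooth Hausdorff Riemannian manifold with Levi-Civita connection $\nabla$ and curvature $R(X,Y)Z=\nabla_X\nabla_YZ-\nabla_Y\nabla_XZ-\nabla_{[X,Y]}Z$, $R(X,Y,Z,T)=g(R(X,Y)Z,T)$. For $(x,u)\in TM$ and $X\in T_xM$ let $X^h, X^v\in T_{(x,u)}TM$ be the horizontal and vertical lifts of $X$. Let $G$ be a $g$-natural metric on $TM$ with smooth coefficient functions $a_j,b_j:[0,\infty)\to\mathbb R$, $j=1,2,3$; that is, with $A=a_1+a_3$, $B=b_1+b_3$ and $r^2=g(u,u)$, for all $x\in M$ and $X,Y,u\in T_xM$, $$G_{(x,u)}(X^h,Y^h)=A(r^2)g(X,Y)+B(r^2)g(X,u)g(Y,u),$$ $$G_{(x,u)}(X^h,Y^v)=G_{(x,u)}(X^v,Y^h)=a_2(r^2)g(X,Y)+b_2(r^2)g(X,u)g(Y,u),$$ $$G_{(x,u)}(X^v,Y^v)=a_1(r^2)g(X,Y)+b_1(r^2)g(X,u)g(Y,u).$$ Assume that $G$ is non-degenerate and let $\widetilde\nabla$ be its Levi-Civita connection. Let $u,X,W,V$ be smooth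 vector fields on $M$ such that the field $W^h+V^v$ is $G$-normal to the submanifold $u(M)\subset TM$ along $u(M)$. Then at every point $z=(p,u(p))$, $p\in M$, with all functions $a_j,b_j,A,B$ and their derivatives taken at $g_p(u,u)$, $$\begin{aligned} G_z(\widetilde\nabla_{u_*(X)}(W^h+V^v),u_*(X))={}&a_1R(u,\nabla_Xu,W,X)+a_2R(u,X,W,X)\\ &+A\,g(X,\nabla_XW)+B\,g(u,X)g(u,\nabla_XW)+B\,g(u,X)g(V,X)\\ &+a_1g(\nabla_Xu,\nabla_XV)+b_1g(u,\nabla_Xu)g(V,\nabla_Xu)+b_1g(u,\nabla_Xu)g(u,\nabla_XV)\\ &+a_2g(X,\nabla_XV)+a_2g(\nabla_Xu,\nabla_XW)\\ &+b_2g(u,X)g(u,\nabla_XV)+b_2g(u,X)g(V,\nabla_Xu)+b_2g(u,\nabla_Xu)g(V,X)\\ &+b_2g(u,\nabla_Xu)g(u,\nabla_XW)\\ &+A'g(u,V)g(X,X)+B'g(u,V)g(u,X)^2+a_1'g(u,V)g(\nabla_Xu,\nabla_Xu)\\ &+2a_2'g(u,V)g(X,\nabla_Xu)+b_1'g(u,V)g(u,\nabla_Xu)^2+2b_2'g(u,V)g(u,X)g(u,\nabla_Xu).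 \end{aligned}$$ Moreover, if the form induced by $G$ on $T_zu(M)$ is non-degenerate, so that the shape operator $A_{W^h+V^v}$ of $u(M)$ is defined at $z$ by the Weingarten decomposition $\widetilde\nabla_{u_*(X)}(W^h+V^v)=-A_{W^h+V^v}u_*(X)+D_{u_*(X)}(W^h+V^v)$ into tangent and normal parts, then $$-G_z(A_{W^h+V^v}u_*(X),u_*(X))=G_z(\widetilde\nabla_{u_*(X)}(W^h+V^v),u_*(X)),$$ so that $-G_z(A_{W^h+V^v}u_*(X),u_*(X))$ is given by the same formula. -/

import Mathlib

open Set Bundle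
open scoped Manifold ContDiff

noncomputable section

namespace GNatural

section LeviCivita

variable {E : Type*} [NormedAddCommGroup E] [NormedSpace ℝ E]
  {H : Type*} [TopologicalSpace H] (I : ModelWithCorners ℝ E H)
  {N : Type*} [TopologicalSpace N] [ChartedSpace H N] [IsManifold I 1 N]

/-- Half of the right-hand side of the Koszul formula for a field `h` of bilinear forms on `N`:
`½ (X h(Y,Z) + Y h(Z,X) - Z h(X,Y) + h([X,Y],Z) - h([Y,Z],X) + h([Z,X],Y))` at the point `x`. -/
def koszul (h : Π x : N, TangentSpace I x →L[ℝ] TangentSpace I x →L[ℝ] ℝ)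
    (X Y Z : Π x : N, TangentSpace I x) (x : N) : ℝ :=
  (1 / 2 : ℝ) *
    (mvfderiv I (fun y => h y (Y y) (Z y)) x (X x)
      + mvfderiv I (fun y => h y (Z y) (X y)) x (Y x)
      - mvfderiv I (fun y => h y (X y) (Y y)) x (Z x)
      + h x (VectorField.mlieBracket I X Y x) (Z x)
      - h x (VectorField.mlieBracket I Y Z x) (X x)
      + h x (VectorField.mlieBracket I Z X x) (Y x))

/-- The covariant derivative `∇_v Y` at `x` for the Levi-Civita connection of a
(pseudo-)Riemannian metric `h` on `N`: the vector `w ∈ T_x N` with `h(w, Z) = koszul X Y Z` at `x`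
for all vector fields `Z`, and all vector fields `X` with `X(x) = v`. -/
def leviCivita (h : Π x : N, TangentSpace I x →L[ℝ] TangentSpace I x →L[ℝ] ℝ)
    (Y : Π x : N, TangentSpace I x) (x : N) (v : TangentSpace I x) : TangentSpace I x :=
  Classical.epsilon fun w : TangentSpace I x =>
    ∀ X Z : Π x : N, TangentSpace I x,
      MDifferentiableAt I I.tangent (fun y => (⟨y, X y⟩ : TangentBundle I N)) x →
      MDifferentiableAt I I.tangent (fun y => (⟨y, Z y⟩ : TangentBundle I N)) x →
      X x = v → h x w (Z x) = koszul I h X Y Z x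

/-- The curvature `R(X,Y)Z = ∇_X ∇_Y Z - ∇_Y ∇_X Z - ∇_{[X,Y]} Z` of the Levi-Civita connection
of `h`. -/
def curvature (h : Π x : N, TangentSpace I x →L[ℝ] TangentSpace I x →L[ℝ] ℝ)
    (X Y Z : Π x : N, TangentSpace I x) (x : N) : TangentSpace I x :=
  leviCivita I h (fun y => leviCivita I h Z y (Y y)) x (X x)
    - leviCivita I h (fun y => leviCivita I h Z y (X y)) x (Y x)
    - leviCivita I h Z x (VectorField.mlieBracket I X Y x)

end LeviCivita

section TangentBundle

variable {E : Type*} [NormedAddCommGroup E] [NormedSpace ℝ E]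
  {M : Type*} [TopologicalSpace M] [ChartedSpace E M] [IsManifold 𝓘(ℝ, E) ∞ M]

/-- Smooth vector fields on `M`. -/
def SmoothField (X : Π x : M, TangentSpace 𝓘(ℝ, E) x) : Prop :=
  ContMDiff 𝓘(ℝ, E) 𝓘(ℝ, E).tangent ∞
    (fun x => (⟨x, X x⟩ : TangentBundle 𝓘(ℝ, E) M))

/-- `T_z TM` is, in Mathlib, the model space `E × E` of `TM`, an element `(v, w)` being the vector
`v^j ∂/∂x^j + w^j ∂/∂u^j` in the coordinates of `TM` induced by the preferred chart of `M` at the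
base point of `z`. -/
def tangentVec (z : TangentBundle 𝓘(ℝ, E) M) (v w : TangentSpace 𝓘(ℝ, E) z.proj) :
    TangentSpace 𝓘(ℝ, E).tangent z :=
  ((v, w) : E × E)

/-- The Christoffel term `Γ(v, u) = v^s u^r Γ^j_{rs} ∂_j` in the preferred chart at `x`: it is the
covariant derivative, in the direction `v`, of the vector field near `x` that has value `u` at `x`
and constant components in that chart. -/
def christoffel (g : Π x : M, TangentSpace 𝓘(ℝ, E) x →L[ℝ] TangentSpace 𝓘(ℝ, E) x →L[ℝ] ℝ)
    (x : M) (v u : TangentSpace 𝓘(ℝ, E) x) : TangentSpace 𝓘(ℝ, E) x :=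
  leviCivita 𝓘(ℝ, E) g (FiberBundle.extend E u) x v

/-- The horizontal lift to `T_z TM` of a vector of `T_x M`, `z = (x, u)`:
`v^h = v^j ∂/∂x^j - u^r v^s Γ^j_{rs} ∂/∂u^j`. -/
def horizontalLift
    (g : Π x : M, TangentSpace 𝓘(ℝ, E) x →L[ℝ] TangentSpace 𝓘(ℝ, E) x →L[ℝ] ℝ)
    (z : TangentBundle 𝓘(ℝ, E) M) (v : TangentSpace 𝓘(ℝ, E) z.proj) :
    TangentSpace 𝓘(ℝ, E).tangent z :=
  tangentVec z v (-christoffel g z.proj v z.snd)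

/-- The vertical lift to `T_z TM` of a vector of `T_x M`, `z = (x, u)`: `v^v = v^j ∂/∂u^j`. -/
def verticalLift (z : TangentBundle 𝓘(ℝ, E) M) (v : TangentSpace 𝓘(ℝ, E) z.proj) :
    TangentSpace 𝓘(ℝ, E).tangent z :=
  tangentVec z 0 v

/-- The vector field `W^h + V^v` on `TM`. -/
def liftField (g : Π x : M, TangentSpace 𝓘(ℝ, E) x →L[ℝ] TangentSpace 𝓘(ℝ, E) x →L[ℝ] ℝ)
    (W V : Π x : M, TangentSpace 𝓘(ℝ, E) x) (z : TangentBundle 𝓘(ℝ, E) M) :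
    TangentSpace 𝓘(ℝ, E).tangent z :=
  horizontalLift g z (W z.proj) + verticalLift z (V z.proj)

/-- The six coefficient functions of a `g`-natural metric, smooth on `[0, ∞)`
(their values at negative numbers play no role). -/
structure Coeffs where
  a₁ : ℝ → ℝ
  a₂ : ℝ → ℝ
  a₃ : ℝ → ℝ
  b₁ : ℝ → ℝ
  b₂ : ℝ → ℝ
  b₃ : ℝ → ℝ
  smooth_a₁ : ContDiffOn ℝ ∞ a₁ (Ici 0)
  smooth_a₂ : ContDiffOn ℝ ∞ a₂ (Ici 0)
  smooth_a₃ : ContDiffOn ℝ ∞ a₃ (Ici 0)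
  smooth_b₁ : ContDiffOn ℝ ∞ b₁ (Ici 0)
  smooth_b₂ : ContDiffOn ℝ ∞ b₂ (Ici 0)
  smooth_b₃ : ContDiffOn ℝ ∞ b₃ (Ici 0)

/-- `A = a₁ + a₃`. -/
def Coeffs.A (c : Coeffs) (t : ℝ) : ℝ := c.a₁ t + c.a₃ t

/-- `B = b₁ + b₃`. -/
def Coeffs.B (c : Coeffs) (t : ℝ) : ℝ := c.b₁ t + c.b₃ t

/-- `G` is the `g`-natural metric on `TM` with coefficient functions `c`. -/
structure IsGNatural
    (g : Π x : M, TangentSpace 𝓘(ℝ, E) x →L[ℝ] TangentSpace 𝓘(ℝ, E) x →L[ℝ] ℝ)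
    (c : Coeffs)
    (G : Π z : TangentBundle 𝓘(ℝ, E) M, TangentSpace 𝓘(ℝ, E).tangent z →L[ℝ]
      TangentSpace 𝓘(ℝ, E).tangent z →L[ℝ] ℝ) : Prop where
  hor_hor : ∀ (x : M) (u X Y : TangentSpace 𝓘(ℝ, E) x),
    G ⟨x, u⟩ (horizontalLift g ⟨x, u⟩ X) (horizontalLift g ⟨x, u⟩ Y)
      = c.A (g x u u) * g x X Y + c.B (g x u u) * g x X u * g x Y u
  hor_ver : ∀ (x : M) (u X Y : TangentSpace 𝓘(ℝ, E) x),
    G ⟨x, u⟩ (horizontalLift g ⟨x, u⟩ X) (verticalLift ⟨x, u⟩ Y)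
      = c.a₂ (g x u u) * g x X Y + c.b₂ (g x u u) * g x X u * g x Y u
  ver_hor : ∀ (x : M) (u X Y : TangentSpace 𝓘(ℝ, E) x),
    G ⟨x, u⟩ (verticalLift ⟨x, u⟩ X) (horizontalLift g ⟨x, u⟩ Y)
      = c.a₂ (g x u u) * g x X Y + c.b₂ (g x u u) * g x X u * g x Y u
  ver_ver : ∀ (x : M) (u X Y : TangentSpace 𝓘(ℝ, E) x),
    G ⟨x, u⟩ (verticalLift ⟨x, u⟩ X) (verticalLift ⟨x, u⟩ Y)
      = c.a₁ (g x u u) * g x X Y + c.b₁ (g x u u) * g x X u * g x Y u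

/-- `G` is non-degenerate at every point of `TM`. -/
def Nondegenerate
    (G : Π z : TangentBundle 𝓘(ℝ, E) M, TangentSpace 𝓘(ℝ, E).tangent z →L[ℝ]
      TangentSpace 𝓘(ℝ, E).tangent z →L[ℝ] ℝ) : Prop :=
  ∀ z, ∀ ξ : TangentSpace 𝓘(ℝ, E).tangent z, (∀ ζ, G z ξ ζ = 0) → ξ = 0

/-- The differential `u_* : T_p M → T_z TM`, `z = (p, u(p))`, of a vector field regarded as a map
`u : M → TM`. Its range is the tangent space at `z` of the submanifold `u(M)`. -/
def push (u : Π x : M, TangentSpace 𝓘(ℝ, E) x) (p : M) :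
    TangentSpace 𝓘(ℝ, E) p →L[ℝ]
      TangentSpace 𝓘(ℝ, E).tangent (⟨p, u p⟩ : TangentBundle 𝓘(ℝ, E) M) :=
  mfderiv 𝓘(ℝ, E) 𝓘(ℝ, E).tangent (fun x => (⟨x, u x⟩ : TangentBundle 𝓘(ℝ, E) M)) p

/-- `ξ ∈ T_z TM` is normal to `u(M)` at `z = (p, u(p))`. -/
def IsNormal
    (G : Π z : TangentBundle 𝓘(ℝ, E) M, TangentSpace 𝓘(ℝ, E).tangent z →L[ℝ]
      TangentSpace 𝓘(ℝ, E).tangent z →L[ℝ] ℝ)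
    (u : Π x : M, TangentSpace 𝓘(ℝ, E) x) (p : M)
    (ξ : TangentSpace 𝓘(ℝ, E).tangent (⟨p, u p⟩ : TangentBundle 𝓘(ℝ, E) M)) : Prop :=
  ∀ v : TangentSpace 𝓘(ℝ, E) p, G ⟨p, u p⟩ ξ (push u p v) = 0

/-- The form induced by `G` on the tangent space of `u(M)` at `z = (p, u(p))` is non-degenerate,
i.e. `T_z TM` is the direct sum of the tangent and the normal space of `u(M)`. -/
def InducedNondegenerateAt
    (G : Π z : TangentBundle 𝓘(ℝ, E) M, TangentSpace 𝓘(ℝ, E).tangent z →L[ℝ]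
      TangentSpace 𝓘(ℝ, E).tangent z →L[ℝ] ℝ)
    (u : Π x : M, TangentSpace 𝓘(ℝ, E) x) (p : M) : Prop :=
  ∀ v : TangentSpace 𝓘(ℝ, E) p, IsNormal G u p (push u p v) → push u p v = 0

/-- The shape operator of `u(M)` in `(TM, G)`, applied to `u_*(v)`, for a vector field `η` on `TM`
that is normal along `u(M)`: the tangential vector `S = A_η u_*(v)` of the Weingarten
decomposition `∇̃_{u_*(v)} η = -S + D` with `S` tangent and `D` normal to `u(M)`, where `∇̃` is the
Levi-Civita connection of `G`. -/
def shapeOperator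
    (G : Π z : TangentBundle 𝓘(ℝ, E) M, TangentSpace 𝓘(ℝ, E).tangent z →L[ℝ]
      TangentSpace 𝓘(ℝ, E).tangent z →L[ℝ] ℝ)
    (u : Π x : M, TangentSpace 𝓘(ℝ, E) x)
    (η : Π z : TangentBundle 𝓘(ℝ, E) M, TangentSpace 𝓘(ℝ, E).tangent z) (p : M)
    (v : TangentSpace 𝓘(ℝ, E) p) :
    TangentSpace 𝓘(ℝ, E).tangent (⟨p, u p⟩ : TangentBundle 𝓘(ℝ, E) M) :=
  Classical.epsilon fun S =>
    (∃ s : TangentSpace 𝓘(ℝ, E) p, push u p s = S) ∧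
    ∃ D : TangentSpace 𝓘(ℝ, E).tangent (⟨p, u p⟩ : TangentBundle 𝓘(ℝ, E) M),
      IsNormal G u p D ∧
      leviCivita 𝓘(ℝ, E).tangent G η ⟨p, u p⟩ (push u p v) = -S + D

/-- The derivative of a function on `[0, ∞)` (one-sided at `0`). -/
def dIci (f : ℝ → ℝ) (t : ℝ) : ℝ := derivWithin f (Ici 0) t

end TangentBundle

end GNatural

end

/-! Write `ξ = u_*(X)` and `η = W^h + V^v`. Only the diagonal value `G(∇̃_ξ η, ξ)` is wanted, and
there the Christoffel symbol of the first kind collapses: two of its three derivatives cancel by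
symmetry of `G`, so in a chart the value is `G(D_ξ η, ξ) + ½ (D_η G)(ξ, ξ)`, with `ξ` in the last
term frozen as a constant vector (`form_leviCivita_self`). No formula for `∇̃` and no explicit
inverse of `G` is needed.

In a chart, `TM` is a piece of `E × E` and the vertical part of `(a, b)` at `(e, u)` is `b + Γ(a,
u)` (`connector`), so `G` becomes the explicit expression `natForm`. Moreover `ξ = (X, D_X u)` has
horizontal part `X` and vertical part `∇_X u`, while `η = (W, V - Γ(W, u))`. Differentiating
`natForm` with the metric property of `∇` turns every derivative into a covariant one: `g(u,u)`
changes at rate `2 g(u,V)`, which produces the terms with `A', B', a_j', b_j'`, while the frozen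
horizontal and vertical parts of `ξ` change by vectors `N` and `K` (`fderiv_natForm_diag`).

On the other side, `D_ξ η` has horizontal part `∇_X W - N` and vertical part `∇_X V - R(X,W)u - K`.
Hence `N` and `K` cancel in the sum, and what is left is tensorial (`natForm_add_half_fderiv`). The
curvature terms take the stated form because `g(R(X,W)u, u) = 0` and, by pair symmetry, `-g(R(X,W)u,
Y) = R(u,Y,W,X)`.

The statement on the shape operator is pairing the Weingarten decomposition with a tangent vector;
the decomposition exists because the induced form is non-degenerate. -/

set_option maxSynthPendingDepth 3

noncomputable section

namespace GNatural

/-! ### Vectors, fields and forms in a preferred chart -/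

section ChartCoordinates

open Filter Topology VectorField

variable {E : Type*} [NormedAddCommGroup E] [NormedSpace ℝ E]
  {H : Type*} [TopologicalSpace H] (I : ModelWithCorners ℝ E H)
  {N : Type*} [TopologicalSpace N] [ChartedSpace H N]

variable {I} in
theorem extChartAt_symm_extChartAt {p y : N} (hy : y ∈ (chartAt H p).source) :
    (extChartAt I p).symm (extChartAt I p y) = y :=
  (extChartAt I p).left_inv (by simpa using hy)

variable {I} in
theorem extChartAt_symm_mem {p : N} {e : E} (he : e ∈ (extChartAt I p).target) :
    (extChartAt I p).symm e ∈ (chartAt H p).source := by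
  simpa using (extChartAt I p).map_target he

variable {I} in
theorem extChartAt_target_nhds [I.Boundaryless] {p y : N} (hy : y ∈ (chartAt H p).source) :
    (extChartAt I p).target ∈ 𝓝 (extChartAt I p y) :=
  extChartAt_target_mem_nhds' ((extChartAt I p).map_source (by simpa using hy))

variable [IsManifold I ∞ N]

/-- The components of a tangent vector at `y` in the preferred chart at `p`. -/
def toCoord (p y : N) : TangentSpace I y →L[ℝ] E :=
  (trivializationAt E (TangentSpace I) p).continuousLinearMapAt ℝ y

/-- The tangent vector at `y` with given components in the preferred chart at `p`. -/
def ofCoord (p y : N) : E →L[ℝ] TangentSpace I y :=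
  (trivializationAt E (TangentSpace I) p).symmL ℝ y

/-- The components of a vector field in the preferred chart at `p`. -/
def fieldRep (p : N) (Y : Π x : N, TangentSpace I x) (e : E) : E :=
  toCoord I p ((extChartAt I p).symm e) (Y ((extChartAt I p).symm e))

/-- The components of a field of bilinear forms in the preferred chart at `p`. -/
def formRep (p : N) (h : Π x : N, TangentSpace I x →L[ℝ] TangentSpace I x →L[ℝ] ℝ) (e : E) :
    E →L[ℝ] E →L[ℝ] ℝ :=
  (ContinuousLinearMap.precomp ℝ (ofCoord I p ((extChartAt I p).symm e))).comp
    ((h ((extChartAt I p).symm e)).comp (ofCoord I p ((extChartAt I p).symm e)))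

variable {I}

theorem toCoord_ofCoord {p y : N} (hy : y ∈ (chartAt H p).source) (a : E) :
    toCoord I p y (ofCoord I p y a) = a :=
  (trivializationAt E (TangentSpace I) p).continuousLinearMapAt_symmL (R := ℝ) hy a

theorem ofCoord_toCoord {p y : N} (hy : y ∈ (chartAt H p).source) (v : TangentSpace I y) :
    ofCoord I p y (toCoord I p y v) = v :=
  (trivializationAt E (TangentSpace I) p).symmL_continuousLinearMapAt (R := ℝ) hy v

theorem toCoord_injective {p y : N} (hy : y ∈ (chartAt H p).source) :
    Function.Injective (toCoord I p y) :=
  Function.LeftInverse.injective (ofCoord_toCoord hy)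

theorem toCoord_eq_mfderiv {p y : N} (hy : y ∈ (chartAt H p).source) :
    toCoord I p y = mfderiv I 𝓘(ℝ, E) (extChartAt I p) y :=
  TangentBundle.continuousLinearMapAt_trivializationAt hy

theorem toCoord_self (p : N) (v : TangentSpace I p) : toCoord I p p v = v := by
  rw [toCoord_eq_mfderiv (mem_chart_source H p), mfderiv_extChartAt_self]
  rfl

theorem toCoord_eq_trivialization {p y : N} (hy : y ∈ (chartAt H p).source)
    (v : TangentSpace I y) :
    toCoord I p y v = (trivializationAt E (TangentSpace I) p ⟨y, v⟩).2 :=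
  (trivializationAt E (TangentSpace I) p).continuousLinearMapAt_apply_of_mem ℝ hy v

theorem fieldRep_extChartAt {p y : N} (hy : y ∈ (chartAt H p).source)
    (Y : Π x : N, TangentSpace I x) :
    fieldRep I p Y (extChartAt I p y) = toCoord I p y (Y y) := by
  have : (extChartAt I p).symm (extChartAt I p y) = y :=
    extChartAt_symm_extChartAt hy
  simp only [fieldRep]
  rw [this]

theorem formRep_extChartAt {p y : N} (hy : y ∈ (chartAt H p).source)
    (h : Π x : N, TangentSpace I x →L[ℝ] TangentSpace I x →L[ℝ] ℝ) (a b : E) :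
    formRep I p h (extChartAt I p y) a b = h y (ofCoord I p y a) (ofCoord I p y b) := by
  have : (extChartAt I p).symm (extChartAt I p y) = y :=
    extChartAt_symm_extChartAt hy
  change h ((extChartAt I p).symm (extChartAt I p y)) _ _ = _
  rw [this]
  rfl

theorem formRep_toCoord {p y : N} (hy : y ∈ (chartAt H p).source)
    (h : Π x : N, TangentSpace I x →L[ℝ] TangentSpace I x →L[ℝ] ℝ) (v w : TangentSpace I y) :
    formRep I p h (extChartAt I p y) (toCoord I p y v) (toCoord I p y w) = h y v w := by
  rw [formRep_extChartAt hy, ofCoord_toCoord hy, ofCoord_toCoord hy]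

/-- Near `y` the function factors as its chart expression after the chart, and the differential of
the chart is `toCoord`; the chain rule does the rest. The chart may be centred at a point `p` other
than `y`, which is what allows local formulas to be differentiated again. -/
theorem mvfderiv_eq_fderiv {F : Type*} [NormedAddCommGroup F]
    [NormedSpace ℝ F] {p y : N} (hy : y ∈ (chartAt H p).source) {f : N → F}
    (hf : DifferentiableAt ℝ (f ∘ (extChartAt I p).symm) (extChartAt I p y))
    (v : TangentSpace I y) :
    mvfderiv I f y v
      = fderiv ℝ (f ∘ (extChartAt I p).symm) (extChartAt I p y) (toCoord I p y v) := by
  have h : f =ᶠ[𝓝 y] (f ∘ (extChartAt I p).symm) ∘ extChartAt I p := by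
    filter_upwards [(chartAt H p).open_source.mem_nhds hy] with x hx
    simp only [Function.comp_apply, extChartAt_symm_extChartAt hx]
  have h1 := h.mfderiv_eq (I := I) (I' := 𝓘(ℝ, F))
  rw [mfderiv_comp y hf.mdifferentiableAt (mdifferentiableAt_extChartAt hy),
    ← toCoord_eq_mfderiv hy, mfderiv_eq_fderiv] at h1
  exact DFunLike.congr_fun h1 v

variable [I.Boundaryless]

theorem contMDiffAt_extChartAt_symm_boundaryless {p y : N} (hy : y ∈ (chartAt H p).source) :
    ContMDiffAt 𝓘(ℝ, E) I ∞ (extChartAt I p).symm (extChartAt I p y) :=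
  (contMDiffOn_extChartAt_symm p).contMDiffAt (extChartAt_target_nhds hy)

theorem contMDiffAt_iff_comp_extChartAt_symm {F : Type*} [NormedAddCommGroup F]
    [NormedSpace ℝ F] {p y : N} (hy : y ∈ (chartAt H p).source)
    {f : N → F} :
    ContMDiffAt I 𝓘(ℝ, F) ∞ f y ↔
      ContDiffAt ℝ ∞ (f ∘ (extChartAt I p).symm) (extChartAt I p y) := by
  have hinv : (extChartAt I p).symm (extChartAt I p y) = y :=
    extChartAt_symm_extChartAt hy
  rw [← contMDiffAt_iff_contDiffAt]
  constructor
  · intro h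
    refine ContMDiffAt.comp _ (g := f) (by rwa [hinv]) ?_
    exact contMDiffAt_extChartAt_symm_boundaryless hy
  · intro h
    have h2 := h.comp y (contMDiffAt_extChartAt' (I := I) (n := ∞) hy)
    refine h2.congr_of_eventuallyEq ?_
    filter_upwards [(chartAt H p).open_source.mem_nhds hy] with x hx
    simp only [Function.comp_apply, extChartAt_symm_extChartAt hx]

theorem mdifferentiableAt_iff_comp_extChartAt_symm {F : Type*} [NormedAddCommGroup F]
    [NormedSpace ℝ F] {p y : N} (hy : y ∈ (chartAt H p).source) {f : N → F} :
    MDifferentiableAt I 𝓘(ℝ, F) f y ↔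
      DifferentiableAt ℝ (f ∘ (extChartAt I p).symm) (extChartAt I p y) := by
  have hinv : (extChartAt I p).symm (extChartAt I p y) = y :=
    extChartAt_symm_extChartAt hy
  rw [← mdifferentiableAt_iff_differentiableAt]
  constructor
  · intro h
    refine MDifferentiableAt.comp _ (g := f) (I' := I) (by rwa [hinv]) ?_
    exact (contMDiffAt_extChartAt_symm_boundaryless hy).mdifferentiableAt (by simp)
  · intro h
    have h2 := h.comp y (mdifferentiableAt_extChartAt (I := I) hy)
    refine h2.congr_of_eventuallyEq ?_
    filter_upwards [(chartAt H p).open_source.mem_nhds hy] with x hx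
    simp only [Function.comp_apply, extChartAt_symm_extChartAt hx]

theorem mdifferentiableAt_iff_fieldRep {p y : N} (hy : y ∈ (chartAt H p).source)
    (Y : Π x : N, TangentSpace I x) :
    MDifferentiableAt I I.tangent (fun x => (⟨x, Y x⟩ : TangentBundle I N)) y ↔
      DifferentiableAt ℝ (fieldRep I p Y) (extChartAt I p y) := by
  rw [(trivializationAt E (TangentSpace I) p).mdifferentiableAt_section_iff I Y hy,
    mdifferentiableAt_iff_comp_extChartAt_symm hy]
  refine Filter.EventuallyEq.differentiableAt_iff ?_
  filter_upwards [extChartAt_target_nhds hy] with e he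
  exact (toCoord_eq_trivialization (extChartAt_symm_mem he) _).symm

theorem contMDiffAt_iff_fieldRep {p y : N}
    (hy : y ∈ (chartAt H p).source) (Y : Π x : N, TangentSpace I x) :
    ContMDiffAt I I.tangent ∞ (fun x => (⟨x, Y x⟩ : TangentBundle I N)) y ↔
      ContDiffAt ℝ ∞ (fieldRep I p Y) (extChartAt I p y) := by
  have h := (trivializationAt E (TangentSpace I) p).contMDiffAt_section_iff
    (IB := I) (n := ∞) (s := Y) hy
  refine h.trans ((contMDiffAt_iff_comp_extChartAt_symm hy).trans ?_)
  have heq : (fun x => (trivializationAt E (TangentSpace I) p ⟨x, Y x⟩).2) ∘ (extChartAt I p).symm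
      =ᶠ[𝓝 (extChartAt I p y)] fieldRep I p Y := by
    filter_upwards [extChartAt_target_nhds hy] with e he
    exact (toCoord_eq_trivialization (extChartAt_symm_mem he) _).symm
  exact ⟨fun h => h.congr_of_eventuallyEq heq.symm, fun h => h.congr_of_eventuallyEq heq⟩

end ChartCoordinates

/-! ### Levi-Civita connection and curvature of a metric on a vector space -/

section FlatConnection

variable {E : Type*} [NormedAddCommGroup E] [NormedSpace ℝ E]

/-- The Christoffel symbols of the first kind of a field `h` of bilinear forms on `E`, built from
its derivative `D`: `½ (∂_a h(b, c) + ∂_b h(a, c) - ∂_c h(a, b))`. -/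
def christoffelLower (D : E →L[ℝ] E →L[ℝ] E →L[ℝ] ℝ) : E →L[ℝ] E →L[ℝ] E →L[ℝ] ℝ :=
  (1 / 2 : ℝ) • (D + D.flip
    - ((ContinuousLinearMap.flipₗᵢ ℝ E E ℝ).toContinuousLinearEquiv :
        (E →L[ℝ] E →L[ℝ] ℝ) →L[ℝ] (E →L[ℝ] E →L[ℝ] ℝ)).comp D.flip)

theorem christoffelLower_apply (D : E →L[ℝ] E →L[ℝ] E →L[ℝ] ℝ) (a b c : E) :
    christoffelLower D a b c = (1 / 2 : ℝ) * (D a b c + D b a c - D c a b) := by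
  simp [christoffelLower]

/-- The Christoffel symbols `Γ(a, b)` of a field `h` of bilinear forms on `E` at the point `e`. -/
def flatChristoffel (h : E → E →L[ℝ] E →L[ℝ] ℝ) (e : E) : E →L[ℝ] E →L[ℝ] E :=
  (ContinuousLinearMap.compL ℝ E (E →L[ℝ] ℝ) E (h e).inverse).comp
    (christoffelLower (fderiv ℝ h e))

theorem form_flatChristoffel {h : E → E →L[ℝ] E →L[ℝ] ℝ} {e : E} (hinv : (h e).IsInvertible)
    (a b c : E) :
    h e (flatChristoffel h e a b) c
      = (1 / 2 : ℝ) * (fderiv ℝ h e a b c + fderiv ℝ h e b a c - fderiv ℝ h e c a b) := by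
  rw [← christoffelLower_apply]
  simp [flatChristoffel, hinv.self_apply_inverse]

theorem contDiffAt_flatChristoffel [CompleteSpace E] {h : E → E →L[ℝ] E →L[ℝ] ℝ} {e : E}
    (hh : ContDiffAt ℝ ∞ h e) (hinv : (h e).IsInvertible) :
    ContDiffAt ℝ ∞ (flatChristoffel h) e := by
  have h1 : ContDiffAt ℝ ∞ (fun e => (h e).inverse) e :=
    (hinv.contDiffAt_map_inverse).comp e hh
  have h2 : ContDiffAt ℝ ∞ (fderiv ℝ h) e := hh.fderiv_right (by simp)
  have h3 : ContDiffAt ℝ ∞ (fun e => christoffelLower (fderiv ℝ h e)) e := by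
    have hflip : ContDiffAt ℝ ∞ (fun e => (fderiv ℝ h e).flip) e :=
      (ContinuousLinearMap.flipₗᵢ ℝ E E
        (E →L[ℝ] ℝ)).toContinuousLinearEquiv.contDiff.contDiffAt.comp e h2
    have hflip' : ContDiffAt ℝ ∞ (fun e =>
        ((ContinuousLinearMap.flipₗᵢ ℝ E E ℝ).toContinuousLinearEquiv :
          (E →L[ℝ] E →L[ℝ] ℝ) →L[ℝ] (E →L[ℝ] E →L[ℝ] ℝ)).comp (fderiv ℝ h e).flip) e :=
      contDiffAt_const.clm_comp hflip
    have hsum := (h2.add hflip).sub hflip'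
    exact hsum.const_smul (1 / 2 : ℝ)
  exact ((ContinuousLinearMap.contDiff _).contDiffAt.comp e h1).clm_comp h3

/-- Evaluation at fixed vectors commutes with differentiation, so the symmetry of nearby forms
passes to the derivative. -/
theorem fderiv_form_symm {h : E → E →L[ℝ] E →L[ℝ] ℝ} {e : E} (hh : DifferentiableAt ℝ h e)
    (hsymm : ∀ᶠ e' in nhds e, ∀ a b, h e' a b = h e' b a) (d a b : E) :
    fderiv ℝ h e d a b = fderiv ℝ h e d b a := by
  have key : ∀ a b : E, fderiv ℝ (fun e' => h e' a b) e d = fderiv ℝ h e d a b := by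
    intro a b
    have h1 := (hh.hasFDerivAt.clm_apply (hasFDerivAt_const a e)).clm_apply (hasFDerivAt_const b e)
    simp [h1.fderiv]
  rw [← key a b, ← key b a]
  have : (fun e' => h e' a b) =ᶠ[nhds e] fun e' => h e' b a := hsymm.mono fun e' H => H a b
  rw [this.fderiv_eq]

theorem flatChristoffel_symm {h : E → E →L[ℝ] E →L[ℝ] ℝ} {e : E} (hh : DifferentiableAt ℝ h e)
    (hsymm : ∀ᶠ e' in nhds e, ∀ a b, h e' a b = h e' b a) (hinv : (h e).IsInvertible) (a b : E) :
    flatChristoffel h e a b = flatChristoffel h e b a := by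
  apply hinv.injective
  ext c
  rw [form_flatChristoffel hinv, form_flatChristoffel hinv, fderiv_form_symm hh hsymm c a b]
  ring

/-- The Levi-Civita connection is metric. -/
theorem fderiv_form_eq {h : E → E →L[ℝ] E →L[ℝ] ℝ} {e : E} (hh : DifferentiableAt ℝ h e)
    (hsymm : ∀ᶠ e' in nhds e, ∀ a b, h e' a b = h e' b a) (hinv : (h e).IsInvertible) (d a b : E) :
    fderiv ℝ h e d a b
      = h e (flatChristoffel h e d a) b + h e a (flatChristoffel h e d b) := by
  rw [hsymm.self_of_nhds a, form_flatChristoffel hinv, form_flatChristoffel hinv,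
    fderiv_form_symm hh hsymm d b a, fderiv_form_symm hh hsymm a d b,
    fderiv_form_symm hh hsymm b d a]
  ring

/-- The Koszul formula in coordinates. -/
theorem koszul_flat {h : E → E →L[ℝ] E →L[ℝ] ℝ} {X Y Z : E → E} {e : E}
    (hh : DifferentiableAt ℝ h e) (hsymm : ∀ᶠ e' in nhds e, ∀ a b, h e' a b = h e' b a)
    (hinv : (h e).IsInvertible)
    (hX : DifferentiableAt ℝ X e) (hY : DifferentiableAt ℝ Y e) (hZ : DifferentiableAt ℝ Z e) :
    (1 / 2 : ℝ) *
      (fderiv ℝ (fun e => h e (Y e) (Z e)) e (X e) + fderiv ℝ (fun e => h e (Z e) (X e)) e (Y e)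
        - fderiv ℝ (fun e => h e (X e) (Y e)) e (Z e)
        + h e (VectorField.lieBracket ℝ X Y e) (Z e)
        - h e (VectorField.lieBracket ℝ Y Z e) (X e)
        + h e (VectorField.lieBracket ℝ Z X e) (Y e))
      = h e (fderiv ℝ Y e (X e) + flatChristoffel h e (X e) (Y e)) (Z e) := by
  -- Product rule for `h(A, B)`. After expanding, the derivatives of `X` and `Z` cancel against the
  -- brackets; those of `Y` add up to `D_X Y`, and those of `h` to the Christoffel symbol.
  have key : ∀ {A B : E → E}, DifferentiableAt ℝ A e → DifferentiableAt ℝ B e → ∀ d,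
      fderiv ℝ (fun e => h e (A e) (B e)) e d
        = fderiv ℝ h e d (A e) (B e) + h e (fderiv ℝ A e d) (B e) + h e (A e) (fderiv ℝ B e d) := by
    intro A B hA hB d
    rw [((hh.hasFDerivAt.clm_apply hA.hasFDerivAt).clm_apply hB.hasFDerivAt).fderiv]
    simp
    ring
  have hs := hsymm.self_of_nhds
  rw [key hY hZ, key hZ hX, key hX hY, map_add, add_apply,
    form_flatChristoffel hinv, fderiv_form_symm hh hsymm (Y e) (Z e)]
  simp only [VectorField.lieBracket, map_sub, sub_apply]
  rw [hs (fderiv ℝ Z e (Y e)) (X e), hs (X e) (fderiv ℝ Y e (Z e)), hs (Y e) (fderiv ℝ Z e (X e)),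
    hs (Z e) (fderiv ℝ X e (Y e))]
  ring

/-- The curvature tensor of `h` at `e`, written with the Christoffel symbols. -/
def flatCurvature (h : E → E →L[ℝ] E →L[ℝ] ℝ) (e a b c : E) : E :=
  fderiv ℝ (flatChristoffel h) e a b c - fderiv ℝ (flatChristoffel h) e b a c
    + flatChristoffel h e a (flatChristoffel h e b c)
    - flatChristoffel h e b (flatChristoffel h e a c)

section Symmetries

variable {h : E → E →L[ℝ] E →L[ℝ] ℝ} {e : E}

theorem flatCurvature_swap (a b c : E) : flatCurvature h e a b c = -flatCurvature h e b a c := by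
  simp only [flatCurvature]
  abel

variable [CompleteSpace E]

theorem fderiv_flatChristoffel_symm (hh : ContDiffAt ℝ ∞ h e)
    (hsymm : ∀ᶠ e' in nhds e, ∀ a b, h e' a b = h e' b a)
    (hinv : ∀ᶠ e' in nhds e, (h e').IsInvertible) (d a b : E) :
    fderiv ℝ (flatChristoffel h) e d a b = fderiv ℝ (flatChristoffel h) e d b a := by
  have hΓ := (contDiffAt_flatChristoffel hh hinv.self_of_nhds).differentiableAt (by simp)
  have key : ∀ a b : E, fderiv ℝ (fun e' => flatChristoffel h e' a b) e d
      = fderiv ℝ (flatChristoffel h) e d a b := by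
    intro a b
    have h1 := (hΓ.hasFDerivAt.clm_apply (hasFDerivAt_const a e)).clm_apply (hasFDerivAt_const b e)
    simp [h1.fderiv]
  rw [← key a b, ← key b a]
  have : (fun e' => flatChristoffel h e' a b) =ᶠ[nhds e] fun e' => flatChristoffel h e' b a := by
    filter_upwards [hsymm.eventually_nhds, hinv,
      (hh.of_le (m := 1) (by simp)).eventually (by simp)] with e' h1 h2 h3
    exact flatChristoffel_symm (h3.differentiableAt (by simp)) h1 h2 a b
  rw [this.fderiv_eq]

/-- Torsion-freeness: `Γ` and its derivative are symmetric in the last two arguments, so the cyclic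
sum cancels in pairs. -/
theorem flatCurvature_bianchi (hh : ContDiffAt ℝ ∞ h e)
    (hsymm : ∀ᶠ e' in nhds e, ∀ a b, h e' a b = h e' b a)
    (hinv : ∀ᶠ e' in nhds e, (h e').IsInvertible) (a b c : E) :
    flatCurvature h e a b c + flatCurvature h e b c a + flatCurvature h e c a b = 0 := by
  have h1 := fderiv_flatChristoffel_symm hh hsymm hinv
  have h2 := flatChristoffel_symm (hh.differentiableAt (by simp)) hsymm hinv.self_of_nhds
  simp only [flatCurvature]
  rw [h1 a b c, h1 b c a, h1 c a b, h2 b c, h2 c a, h2 a b]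
  abel

/-- Differentiating the metric identity `∂_y h(c,d) = h(Γ(y,c),d) + h(c,Γ(y,d))` once more and
antisymmetrising kills the left side, since second derivatives of `h` commute; the right side
becomes `h(R(a,b)c,d) + h(c,R(a,b)d)`. -/
theorem flatCurvature_skew (hh : ContDiffAt ℝ ∞ h e)
    (hsymm : ∀ᶠ e' in nhds e, ∀ a b, h e' a b = h e' b a)
    (hinv : ∀ᶠ e' in nhds e, (h e').IsInvertible) (a b c d : E) :
    h e (flatCurvature h e a b c) d = -h e (flatCurvature h e a b d) c := by
  have hd := hh.differentiableAt (by simp)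
  have hs := hsymm.self_of_nhds
  have hΓ := (contDiffAt_flatChristoffel hh hinv.self_of_nhds).differentiableAt (by simp)
  have hD : DifferentiableAt ℝ (fderiv ℝ h) e :=
    (hh.fderiv_right (m := ∞) (by simp)).differentiableAt (by simp)
  have key : ∀ x y : E, fderiv ℝ (fderiv ℝ h) e x y c d
      = h e (flatChristoffel h e x (flatChristoffel h e y c)) d
        + h e (flatChristoffel h e y c) (flatChristoffel h e x d)
        + h e (fderiv ℝ (flatChristoffel h) e x y c) d
        + h e (flatChristoffel h e x c) (flatChristoffel h e y d)
        + h e c (flatChristoffel h e x (flatChristoffel h e y d))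
        + h e c (fderiv ℝ (flatChristoffel h) e x y d) := by
    intro x y
    have hev : (fun e' => fderiv ℝ h e' y c d) =ᶠ[nhds e] fun e' =>
        h e' (flatChristoffel h e' y c) d + h e' c (flatChristoffel h e' y d) := by
      filter_upwards [hsymm.eventually_nhds, hinv,
        (hh.of_le (m := 1) (by simp)).eventually (by simp)] with e' h1 h2 h3
      exact fderiv_form_eq (h3.differentiableAt (by simp)) h1 h2 y c d
    have hL := ((hD.hasFDerivAt.clm_apply (hasFDerivAt_const y e)).clm_apply
      (hasFDerivAt_const c e)).clm_apply (hasFDerivAt_const d e)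
    have hG : ∀ w, HasFDerivAt (fun e' => flatChristoffel h e' y w) _ e := fun w =>
      (hΓ.hasFDerivAt.clm_apply (hasFDerivAt_const y e)).clm_apply (hasFDerivAt_const w e)
    have hR1 := (hd.hasFDerivAt.clm_apply (hG c)).clm_apply (hasFDerivAt_const d e)
    have hR2 := (hd.hasFDerivAt.clm_apply (hasFDerivAt_const c e)).clm_apply (hG d)
    have := hev.fderiv_eq (𝕜 := ℝ)
    rw [hL.fderiv, (hR1.fun_add hR2).fderiv] at this
    have := DFunLike.congr_fun this x
    simp only [add_apply, ContinuousLinearMap.comp_apply,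
      ContinuousLinearMap.flip_apply, zero_apply, map_zero, zero_add, add_zero,
      fderiv_form_eq hd hsymm hinv.self_of_nhds] at this
    rw [this]
    ring
  have hsnd : fderiv ℝ (fderiv ℝ h) e a b = fderiv ℝ (fderiv ℝ h) e b a :=
    (hh.isSymmSndFDerivAt (by
      rw [minSmoothness_of_isRCLikeNormedField]
      exact WithTop.coe_le_coe.2 (le_top : (2 : ℕ∞) ≤ ⊤))) a b
  have h1 := key a b
  have h2 := key b a
  rw [hsnd] at h1
  rw [h1] at h2
  rw [hs (flatCurvature h e a b d) c]
  simp only [flatCurvature, map_add, map_sub, add_apply,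
    sub_apply]
  linarith

theorem flatCurvature_pair_symm (hh : ContDiffAt ℝ ∞ h e)
    (hsymm : ∀ᶠ e' in nhds e, ∀ a b, h e' a b = h e' b a)
    (hinv : ∀ᶠ e' in nhds e, (h e').IsInvertible) (a b c d : E) :
    h e (flatCurvature h e a b c) d = h e (flatCurvature h e c d a) b := by
  have hsk := flatCurvature_skew hh hsymm hinv
  have hsw : ∀ a b c d, h e (flatCurvature h e a b c) d = -h e (flatCurvature h e b a c) d := by
    intro a b c d
    rw [flatCurvature_swap]
    simp
  have hbi : ∀ a b c d, h e (flatCurvature h e a b c) d + h e (flatCurvature h e b c a) d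
      + h e (flatCurvature h e c a b) d = 0 := by
    intro a b c d
    simpa using congrArg (fun w => h e w d) (flatCurvature_bianchi hh hsymm hinv a b c)
  -- The classical octahedron argument: four Bianchi identities, one for each cyclic shift of `(a,
  -- b, c, d)`, combined linearly with the two skew-symmetries.
  linarith [hbi a b c d, hbi b c d a, hbi c d a b, hbi d a b c, hsk a b c d, hsk b c a d,
    hsk c a b d, hsk b c d a, hsk c d b a, hsk d b c a, hsk c d a b, hsk d a c b, hsk a c d b,
    hsk d a b c, hsk a b d c, hsk b d a c, hsw c a b d, hsw d b c a, hsw a c b d, hsw b d a c,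
    hsw a b c d, hsw c d a b, hsw b c a d, hsw d a b c]

end Symmetries

end FlatConnection

/-! ### From the intrinsic Levi-Civita connection to coordinates -/

section LeviCivitaInCoordinates

open Filter Topology VectorField

theorem isInvertible_of_nondegenerate {E : Type*} [NormedAddCommGroup E] [NormedSpace ℝ E]
    [FiniteDimensional ℝ E] {f : E →L[ℝ] E →L[ℝ] ℝ} (hf : ∀ a, (∀ b, f a b = 0) → a = 0) :
    f.IsInvertible := by
  have hinj : Function.Injective f.toLinearMap := by
    refine (injective_iff_map_eq_zero f.toLinearMap).2 fun a ha => hf a fun b => ?_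
    exact DFunLike.congr_fun ha b
  have hrank : Module.finrank ℝ E = Module.finrank ℝ (E →L[ℝ] ℝ) := by
    rw [← (LinearMap.toContinuousLinearMap (𝕜 := ℝ) (E := E) (F' := ℝ)).finrank_eq]
    exact (Subspace.dual_finrank_eq).symm
  have : FiniteDimensional ℝ (E →L[ℝ] ℝ) :=
    (LinearMap.toContinuousLinearMap (𝕜 := ℝ) (E := E) (F' := ℝ)).finiteDimensional
  refine ⟨(LinearEquiv.ofInjectiveOfFinrankEq f.toLinearMap hinj hrank).toContinuousLinearEquiv, ?_⟩
  ext a b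
  rfl

variable {E : Type*} [NormedAddCommGroup E] [NormedSpace ℝ E]
  {H : Type*} [TopologicalSpace H] {I : ModelWithCorners ℝ E H}
  {N : Type*} [TopologicalSpace N] [ChartedSpace H N] [IsManifold I ∞ N]

theorem formRep_symm {h : Π x : N, TangentSpace I x →L[ℝ] TangentSpace I x →L[ℝ] ℝ}
    (hsymm : ∀ x v w, h x v w = h x w v) (p : N) (e a b : E) :
    formRep I p h e a b = formRep I p h e b a :=
  hsymm _ _ _

theorem isInvertible_formRep [FiniteDimensional ℝ E]
    {h : Π x : N, TangentSpace I x →L[ℝ] TangentSpace I x →L[ℝ] ℝ}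
    {p y : N} (hy : y ∈ (chartAt H p).source)
    (hnd : ∀ v : TangentSpace I y, (∀ w, h y v w = 0) → v = 0) :
    (formRep I p h (extChartAt I p y)).IsInvertible := by
  refine isInvertible_of_nondegenerate fun a ha => ?_
  have : ofCoord I p y a = 0 := hnd _ fun w => by
    have := ha (toCoord I p y w)
    rwa [formRep_extChartAt hy, ofCoord_toCoord hy] at this
  rw [← toCoord_ofCoord (I := I) hy a, this, map_zero]

variable [I.Boundaryless]

theorem mfderiv_extChartAt_symm {p y : N} (hy : y ∈ (chartAt H p).source) :
    mfderiv 𝓘(ℝ, E) I (extChartAt I p).symm (extChartAt I p y) = ofCoord I p y := by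
  rw [ofCoord, TangentBundle.symmL_trivializationAt hy, I.range_eq_univ, mfderivWithin_univ]

theorem comp_symm_eventuallyEq_formRep
    (h : Π x : N, TangentSpace I x →L[ℝ] TangentSpace I x →L[ℝ] ℝ)
    {p y : N} (hy : y ∈ (chartAt H p).source) (Y Z : Π x : N, TangentSpace I x) :
    (fun x => h x (Y x) (Z x)) ∘ (extChartAt I p).symm =ᶠ[𝓝 (extChartAt I p y)]
      fun e => formRep I p h e (fieldRep I p Y e) (fieldRep I p Z e) := by
  filter_upwards [extChartAt_target_nhds hy] with e he
  have h1 := formRep_toCoord (extChartAt_symm_mem he) h (Y _) (Z _)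
  rw [(extChartAt I p).right_inv he] at h1
  exact h1.symm

/-- The differential of the inverse chart is `ofCoord`, whose inverse is `toCoord`. This makes
naturality of the Lie bracket under pullback applicable to coordinate representations. -/
theorem mpullback_extChartAt_symm {p : N} (Y : Π x : N, TangentSpace I x) {e : E}
    (he : e ∈ (extChartAt I p).target) :
    mpullback 𝓘(ℝ, E) I (extChartAt I p).symm Y e = fieldRep I p Y e := by
  have hy := extChartAt_symm_mem (I := I) he
  have h1 := mfderiv_extChartAt_symm (I := I) hy
  rw [(extChartAt I p).right_inv he] at h1
  have h2 : (ofCoord I p ((extChartAt I p).symm e)).inverse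
      = toCoord I p ((extChartAt I p).symm e) :=
    ContinuousLinearMap.inverse_eq (ContinuousLinearMap.ext fun v => ofCoord_toCoord hy v)
      (ContinuousLinearMap.ext fun a => toCoord_ofCoord hy a)
  rw [mpullback_apply, h1]
  exact DFunLike.congr_fun h2 _

variable [FiniteDimensional ℝ E]

theorem toCoord_mlieBracket {p y : N} (hy : y ∈ (chartAt H p).source)
    {X Y : Π x : N, TangentSpace I x}
    (hX : MDifferentiableAt I I.tangent (fun x => (⟨x, X x⟩ : TangentBundle I N)) y)
    (hY : MDifferentiableAt I I.tangent (fun x => (⟨x, Y x⟩ : TangentBundle I N)) y) :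
    toCoord I p y (mlieBracket I X Y y)
      = lieBracket ℝ (fieldRep I p X) (fieldRep I p Y) (extChartAt I p y) := by
  have hinv := extChartAt_symm_extChartAt (I := I) hy
  have hmem : extChartAt I p y ∈ (extChartAt I p).target :=
    mem_of_mem_nhds (extChartAt_target_nhds hy)
  have : IsManifold I (minSmoothness ℝ 3) N := by
    rw [minSmoothness_of_isRCLikeNormedField]
    exact IsManifold.of_le (n := ∞) (WithTop.coe_le_coe.2 (le_top : (3 : ℕ∞) ≤ ⊤))
  have key := mpullback_mlieBracket (I := 𝓘(ℝ, E)) (I' := I) (f := (extChartAt I p).symm)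
    (x₀ := extChartAt I p y) (V := X) (W := Y) (n := ∞) (by rwa [hinv]) (by rwa [hinv])
    (contMDiffAt_extChartAt_symm_boundaryless hy) (by
      rw [minSmoothness_of_isRCLikeNormedField]
      exact WithTop.coe_le_coe.2 (le_top : (2 : ℕ∞) ≤ ⊤))
  rw [mpullback_extChartAt_symm _ hmem, fieldRep_extChartAt hy] at key
  rw [key, ← mlieBracketWithin_univ, mlieBracketWithin_eq_lieBracketWithin]
  refine (congrFun (lieBracketWithin_univ (𝕜 := ℝ)) _).trans ?_
  apply Filter.EventuallyEq.lieBracket_vectorField_eq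
  · filter_upwards [extChartAt_target_nhds hy] with e he using mpullback_extChartAt_symm _ he
  · filter_upwards [extChartAt_target_nhds hy] with e he using mpullback_extChartAt_symm _ he

theorem koszul_eq {h : Π x : N, TangentSpace I x →L[ℝ] TangentSpace I x →L[ℝ] ℝ}
    {p y : N} (hy : y ∈ (chartAt H p).source)
    (hh : DifferentiableAt ℝ (formRep I p h) (extChartAt I p y))
    (hsymm : ∀ x v w, h x v w = h x w v)
    (hnd : ∀ v : TangentSpace I y, (∀ w, h y v w = 0) → v = 0)
    {X Y Z : Π x : N, TangentSpace I x}
    (hX : MDifferentiableAt I I.tangent (fun x => (⟨x, X x⟩ : TangentBundle I N)) y)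
    (hY : MDifferentiableAt I I.tangent (fun x => (⟨x, Y x⟩ : TangentBundle I N)) y)
    (hZ : MDifferentiableAt I I.tangent (fun x => (⟨x, Z x⟩ : TangentBundle I N)) y) :
    koszul I h X Y Z y = formRep I p h (extChartAt I p y)
      (fderiv ℝ (fieldRep I p Y) (extChartAt I p y) (toCoord I p y (X y))
        + flatChristoffel (formRep I p h) (extChartAt I p y) (toCoord I p y (X y))
          (toCoord I p y (Y y))) (toCoord I p y (Z y)) := by
  have hX' := (mdifferentiableAt_iff_fieldRep hy X).1 hX
  have hY' := (mdifferentiableAt_iff_fieldRep hy Y).1 hY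
  have hZ' := (mdifferentiableAt_iff_fieldRep hy Z).1 hZ
  have hscal : ∀ {A B : Π x : N, TangentSpace I x},
      DifferentiableAt ℝ (fieldRep I p A) (extChartAt I p y) →
      DifferentiableAt ℝ (fieldRep I p B) (extChartAt I p y) → ∀ v : TangentSpace I y,
      mvfderiv I (fun x => h x (A x) (B x)) y v
        = fderiv ℝ (fun e => formRep I p h e (fieldRep I p A e) (fieldRep I p B e))
            (extChartAt I p y) (toCoord I p y v) := by
    intro A B hA hB v
    have heq := comp_symm_eventuallyEq_formRep h hy A B
    rw [mvfderiv_eq_fderiv hy (heq.differentiableAt_iff.2 ((hh.clm_apply hA).clm_apply hB)),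
      heq.fderiv_eq]
  have hflat := koszul_flat hh (Eventually.of_forall (formRep_symm hsymm p))
    (isInvertible_formRep hy hnd) hX' hY' hZ'
  rw [fieldRep_extChartAt hy, fieldRep_extChartAt hy, fieldRep_extChartAt hy] at hflat
  rw [← hflat, koszul, hscal hY' hZ', hscal hZ' hX', hscal hX' hY',
    ← toCoord_mlieBracket hy hX hY, ← toCoord_mlieBracket hy hY hZ, ← toCoord_mlieBracket hy hZ hX,
    formRep_toCoord hy, formRep_toCoord hy, formRep_toCoord hy]

/-- The Levi-Civita connection in the coordinates of the preferred chart at `p`. -/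
theorem toCoord_leviCivita {h : Π x : N, TangentSpace I x →L[ℝ] TangentSpace I x →L[ℝ] ℝ}
    {p y : N} (hy : y ∈ (chartAt H p).source)
    (hh : DifferentiableAt ℝ (formRep I p h) (extChartAt I p y))
    (hsymm : ∀ x v w, h x v w = h x w v)
    (hnd : ∀ v : TangentSpace I y, (∀ w, h y v w = 0) → v = 0)
    {Y : Π x : N, TangentSpace I x}
    (hY : MDifferentiableAt I I.tangent (fun x => (⟨x, Y x⟩ : TangentBundle I N)) y)
    (v : TangentSpace I y) :
    toCoord I p y (leviCivita I h Y y v)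
      = fderiv ℝ (fieldRep I p Y) (extChartAt I p y) (toCoord I p y v)
        + flatChristoffel (formRep I p h) (extChartAt I p y) (toCoord I p y v)
          (toCoord I p y (Y y)) := by
  set w₀ := fderiv ℝ (fieldRep I p Y) (extChartAt I p y) (toCoord I p y v)
        + flatChristoffel (formRep I p h) (extChartAt I p y) (toCoord I p y v)
          (toCoord I p y (Y y)) with hw₀
  have hex : ∃ w : TangentSpace I y, ∀ X Z : Π x : N, TangentSpace I x,
      MDifferentiableAt I I.tangent (fun x => (⟨x, X x⟩ : TangentBundle I N)) y →
      MDifferentiableAt I I.tangent (fun x => (⟨x, Z x⟩ : TangentBundle I N)) y →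
      X y = v → h y w (Z y) = koszul I h X Y Z y := by
    -- The coordinate expression satisfies the Koszul condition, so the vector chosen by
    -- `Classical.epsilon` satisfies it too; non-degeneracy then forces the two to agree.
    refine ⟨ofCoord I p y w₀, fun X Z hX hZ hXv => ?_⟩
    rw [koszul_eq hy hh hsymm hnd hX hY hZ, hXv, ← formRep_toCoord hy, toCoord_ofCoord hy]
  have hspec := Classical.epsilon_spec hex
  apply (isInvertible_formRep hy hnd).injective
  ext c
  -- Test fields: any extension of `v`, and an extension of the vector with arbitrary components
  -- `c`, which suffices to compare two vectors through `h`.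
  have h1 := hspec (FiberBundle.extend E v) (FiberBundle.extend E (ofCoord I p y c))
    (FiberBundle.mdifferentiableAt_extend I E v) (FiberBundle.mdifferentiableAt_extend I E _)
    (FiberBundle.extend_apply_self E v)
  rw [koszul_eq hy hh hsymm hnd (FiberBundle.mdifferentiableAt_extend I E v) hY
    (FiberBundle.mdifferentiableAt_extend I E _), FiberBundle.extend_apply_self,
    FiberBundle.extend_apply_self, toCoord_ofCoord hy, ← hw₀] at h1
  rw [← h1, ← formRep_toCoord hy, toCoord_ofCoord hy]
  rfl

end LeviCivitaInCoordinates

/-! ### The Riemannian metric on the base and its curvature -/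

section RiemannianMetric

open Filter Topology VectorField

variable {E : Type*} [NormedAddCommGroup E] [NormedSpace ℝ E]
  {M : Type*} [TopologicalSpace M] [ChartedSpace E M] [IsManifold 𝓘(ℝ, E) ∞ M]
  (metric : ContMDiffRiemannianMetric 𝓘(ℝ, E) ∞ E (fun x : M => TangentSpace 𝓘(ℝ, E) x))

theorem metric_nondegenerate (y : M) (v : TangentSpace 𝓘(ℝ, E) y)
    (hv : ∀ w, metric.inner y v w = 0) : v = 0 := by
  by_contra hne
  exact (metric.pos y v hne).ne' (hv v)

theorem fieldRep_ofCoord {p : M} (a : E) {e : E} (he : e ∈ (extChartAt 𝓘(ℝ, E) p).target) :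
    fieldRep 𝓘(ℝ, E) p (fun x => ofCoord 𝓘(ℝ, E) p x a) e = a :=
  toCoord_ofCoord (extChartAt_symm_mem he) a

theorem fieldRep_ofCoord_eventuallyEq {p y : M} (hy : y ∈ (chartAt E p).source) (a : E) :
    fieldRep 𝓘(ℝ, E) p (fun x => ofCoord 𝓘(ℝ, E) p x a)
      =ᶠ[𝓝 (extChartAt 𝓘(ℝ, E) p y)] fun _ => a := by
  filter_upwards [extChartAt_target_nhds hy] with e he using fieldRep_ofCoord a he

theorem contMDiffAt_ofCoord {p y : M} (hy : y ∈ (chartAt E p).source) (a : E) :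
    ContMDiffAt 𝓘(ℝ, E) 𝓘(ℝ, E).tangent ∞
      (fun x => (⟨x, ofCoord 𝓘(ℝ, E) p x a⟩ : TangentBundle 𝓘(ℝ, E) M)) y :=
  (contMDiffAt_iff_fieldRep hy _).2
    (contDiffAt_const.congr_of_eventuallyEq (fieldRep_ofCoord_eventuallyEq hy a))

theorem SmoothField.contDiffAt_fieldRep {Y : Π x : M, TangentSpace 𝓘(ℝ, E) x}
    (hY : SmoothField Y) {p y : M} (hy : y ∈ (chartAt E p).source) :
    ContDiffAt ℝ ∞ (fieldRep 𝓘(ℝ, E) p Y) (extChartAt 𝓘(ℝ, E) p y) :=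
  (contMDiffAt_iff_fieldRep hy Y).1 (hY y)

theorem SmoothField.mdifferentiableAt {Y : Π x : M, TangentSpace 𝓘(ℝ, E) x}
    (hY : SmoothField Y) (y : M) :
    MDifferentiableAt 𝓘(ℝ, E) 𝓘(ℝ, E).tangent
      (fun x => (⟨x, Y x⟩ : TangentBundle 𝓘(ℝ, E) M)) y :=
  (hY y).mdifferentiableAt (by simp)

variable [FiniteDimensional ℝ E]

/-- In finite dimension it is enough to evaluate on fixed vectors; these are the components of the
smooth chart-constant fields, on which the smooth metric takes smooth values. -/
theorem contDiffOn_formRep_metric (p : M) :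
    ContDiffOn ℝ ∞ (formRep 𝓘(ℝ, E) p metric.inner) (extChartAt 𝓘(ℝ, E) p).target := by
  refine contDiffOn_clm_apply.2 fun a => contDiffOn_clm_apply.2 fun b => ?_
  intro e he
  have hy : (extChartAt 𝓘(ℝ, E) p).symm e ∈ (chartAt E p).source := extChartAt_symm_mem he
  have h1 := ContMDiffAt.clm_bundle_apply₂ (F₃ := ℝ) (E₃ := Bundle.Trivial M ℝ)
    (b := fun x : M => x)
    (metric.contMDiff ((extChartAt 𝓘(ℝ, E) p).symm e)) (contMDiffAt_ofCoord hy a)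
    (contMDiffAt_ofCoord hy b)
  have h2 := (contMDiffAt_totalSpace.1 h1).2
  have h3 := (contMDiffAt_iff_comp_extChartAt_symm hy).1 h2
  rw [(extChartAt 𝓘(ℝ, E) p).right_inv he] at h3
  exact h3.contDiffWithinAt

theorem contDiffAt_formRep_metric {p y : M} (hy : y ∈ (chartAt E p).source) :
    ContDiffAt ℝ ∞ (formRep 𝓘(ℝ, E) p metric.inner) (extChartAt 𝓘(ℝ, E) p y) :=
  (contDiffOn_formRep_metric metric p).contDiffAt (extChartAt_target_nhds hy)

theorem isInvertible_formRep_metric {p : M} {e : E}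
    (he : e ∈ (extChartAt 𝓘(ℝ, E) p).target) :
    (formRep 𝓘(ℝ, E) p metric.inner e).IsInvertible := by
  have h1 := isInvertible_formRep (h := metric.inner) (extChartAt_symm_mem he)
    (metric_nondegenerate metric _)
  rwa [(extChartAt 𝓘(ℝ, E) p).right_inv he] at h1

theorem contDiffAt_flatChristoffel_metric {p y : M} (hy : y ∈ (chartAt E p).source) :
    ContDiffAt ℝ ∞ (flatChristoffel (formRep 𝓘(ℝ, E) p metric.inner)) (extChartAt 𝓘(ℝ, E) p y) :=
  have : CompleteSpace E := FiniteDimensional.complete ℝ E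
  contDiffAt_flatChristoffel (contDiffAt_formRep_metric metric hy)
    (isInvertible_formRep_metric metric (mem_of_mem_nhds (extChartAt_target_nhds hy)))

theorem toCoord_leviCivita_metric {p y : M} (hy : y ∈ (chartAt E p).source)
    {Y : Π x : M, TangentSpace 𝓘(ℝ, E) x}
    (hY : MDifferentiableAt 𝓘(ℝ, E) 𝓘(ℝ, E).tangent
      (fun x => (⟨x, Y x⟩ : TangentBundle 𝓘(ℝ, E) M)) y)
    (v : TangentSpace 𝓘(ℝ, E) y) :
    toCoord 𝓘(ℝ, E) p y (leviCivita 𝓘(ℝ, E) metric.inner Y y v)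
      = fderiv ℝ (fieldRep 𝓘(ℝ, E) p Y) (extChartAt 𝓘(ℝ, E) p y) (toCoord 𝓘(ℝ, E) p y v)
        + flatChristoffel (formRep 𝓘(ℝ, E) p metric.inner) (extChartAt 𝓘(ℝ, E) p y)
          (toCoord 𝓘(ℝ, E) p y v) (toCoord 𝓘(ℝ, E) p y (Y y)) :=
  toCoord_leviCivita hy ((contDiffAt_formRep_metric metric hy).differentiableAt (by simp))
    metric.symm (metric_nondegenerate metric y) hY v

/-- Holds on a neighbourhood and not just at the point, so the right side can be differentiated to
give second covariant derivatives. -/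
theorem fieldRep_leviCivita {Y Z : Π x : M, TangentSpace 𝓘(ℝ, E) x} (hZ : SmoothField Z)
    {p y : M} (hy : y ∈ (chartAt E p).source) :
    fieldRep 𝓘(ℝ, E) p (fun x => leviCivita 𝓘(ℝ, E) metric.inner Z x (Y x))
      =ᶠ[𝓝 (extChartAt 𝓘(ℝ, E) p y)] fun e =>
        fderiv ℝ (fieldRep 𝓘(ℝ, E) p Z) e (fieldRep 𝓘(ℝ, E) p Y e)
          + flatChristoffel (formRep 𝓘(ℝ, E) p metric.inner) e (fieldRep 𝓘(ℝ, E) p Y e)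
            (fieldRep 𝓘(ℝ, E) p Z e) := by
  filter_upwards [extChartAt_target_nhds hy] with e he
  have h1 := toCoord_leviCivita_metric metric (extChartAt_symm_mem he)
    (hZ.mdifferentiableAt _) (Y ((extChartAt 𝓘(ℝ, E) p).symm e))
  rw [(extChartAt 𝓘(ℝ, E) p).right_inv he] at h1
  exact h1

theorem SmoothField.leviCivita {Y Z : Π x : M, TangentSpace 𝓘(ℝ, E) x} (hY : SmoothField Y)
    (hZ : SmoothField Z) :
    SmoothField (fun x => leviCivita 𝓘(ℝ, E) metric.inner Z x (Y x)) := by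
  intro y
  have hy := mem_chart_source E y
  refine (contMDiffAt_iff_fieldRep hy _).2 ?_
  refine ContDiffAt.congr_of_eventuallyEq ?_ (fieldRep_leviCivita metric hZ hy)
  have hY' := hY.contDiffAt_fieldRep hy
  have hZ' := hZ.contDiffAt_fieldRep hy
  exact ((hZ'.fderiv_right (m := ∞) (by simp)).clm_apply hY').add
    (((contDiffAt_flatChristoffel_metric metric hy).clm_apply hY').clm_apply hZ')

/-- The curvature in the coordinates of the preferred chart at `p`. -/
theorem toCoord_curvature {X Y Z : Π x : M, TangentSpace 𝓘(ℝ, E) x} (hX : SmoothField X)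
    (hY : SmoothField Y) (hZ : SmoothField Z) (p : M) :
    toCoord 𝓘(ℝ, E) p p (curvature 𝓘(ℝ, E) metric.inner X Y Z p)
      = flatCurvature (formRep 𝓘(ℝ, E) p metric.inner) (extChartAt 𝓘(ℝ, E) p p)
        (toCoord 𝓘(ℝ, E) p p (X p)) (toCoord 𝓘(ℝ, E) p p (Y p))
        (toCoord 𝓘(ℝ, E) p p (Z p)) := by
  have hp := mem_chart_source E p
  set e := extChartAt 𝓘(ℝ, E) p p with he
  set Γ := flatChristoffel (formRep 𝓘(ℝ, E) p metric.inner) with hΓdef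
  have hΓ : DifferentiableAt ℝ Γ e :=
    (contDiffAt_flatChristoffel_metric metric hp).differentiableAt (by simp)
  have hrep : ∀ {A : Π x : M, TangentSpace 𝓘(ℝ, E) x},
      toCoord 𝓘(ℝ, E) p p (A p) = fieldRep 𝓘(ℝ, E) p A e := fun {A} =>
    (fieldRep_extChartAt hp A).symm
  have hZ2 : DifferentiableAt ℝ (fderiv ℝ (fieldRep 𝓘(ℝ, E) p Z)) e :=
    ((hZ.contDiffAt_fieldRep hp).fderiv_right (m := ∞) (by simp)).differentiableAt (by simp)
  have hZ1 : DifferentiableAt ℝ (fieldRep 𝓘(ℝ, E) p Z) e :=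
    (hZ.contDiffAt_fieldRep hp).differentiableAt (by simp)
  have hsecond : ∀ {A B : Π x : M, TangentSpace 𝓘(ℝ, E) x}, SmoothField A → SmoothField B →
      toCoord 𝓘(ℝ, E) p p (GNatural.leviCivita 𝓘(ℝ, E) metric.inner
        (fun y => GNatural.leviCivita 𝓘(ℝ, E) metric.inner Z y (B y)) p (A p))
      = fderiv ℝ (fderiv ℝ (fieldRep 𝓘(ℝ, E) p Z)) e (fieldRep 𝓘(ℝ, E) p A e)
          (fieldRep 𝓘(ℝ, E) p B e)
        + fderiv ℝ (fieldRep 𝓘(ℝ, E) p Z) e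
          (fderiv ℝ (fieldRep 𝓘(ℝ, E) p B) e (fieldRep 𝓘(ℝ, E) p A e))
        + fderiv ℝ Γ e (fieldRep 𝓘(ℝ, E) p A e) (fieldRep 𝓘(ℝ, E) p B e) (fieldRep 𝓘(ℝ, E) p Z e)
        + Γ e (fderiv ℝ (fieldRep 𝓘(ℝ, E) p B) e (fieldRep 𝓘(ℝ, E) p A e))
          (fieldRep 𝓘(ℝ, E) p Z e)
        + Γ e (fieldRep 𝓘(ℝ, E) p B e)
          (fderiv ℝ (fieldRep 𝓘(ℝ, E) p Z) e (fieldRep 𝓘(ℝ, E) p A e))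
        + Γ e (fieldRep 𝓘(ℝ, E) p A e)
          (fderiv ℝ (fieldRep 𝓘(ℝ, E) p Z) e (fieldRep 𝓘(ℝ, E) p B e))
        + Γ e (fieldRep 𝓘(ℝ, E) p A e)
          (Γ e (fieldRep 𝓘(ℝ, E) p B e) (fieldRep 𝓘(ℝ, E) p Z e)) := by
    intro A B hA hB
    have hB1 : DifferentiableAt ℝ (fieldRep 𝓘(ℝ, E) p B) e :=
      (hB.contDiffAt_fieldRep hp).differentiableAt (by simp)
    have hev := fieldRep_leviCivita metric (Y := B) hZ hp
    rw [toCoord_leviCivita_metric metric hp ((hB.leviCivita metric hZ).mdifferentiableAt p),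
      ← fieldRep_extChartAt hp (fun y => GNatural.leviCivita 𝓘(ℝ, E) metric.inner Z y (B y)),
      hev.fderiv_eq, hev.self_of_nhds, hrep, ← he, ← hΓdef,
      ((hZ2.hasFDerivAt.clm_apply hB1.hasFDerivAt).fun_add
        ((hΓ.hasFDerivAt.clm_apply hB1.hasFDerivAt).clm_apply hZ1.hasFDerivAt)).fderiv]
    simp only [add_apply, ContinuousLinearMap.comp_apply, ContinuousLinearMap.flip_apply, map_add]
    abel
  have hbr := toCoord_mlieBracket hp (hX.mdifferentiableAt p) (hY.mdifferentiableAt p)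
  -- In the commutator the second derivatives of `Z` cancel by symmetry and the first derivatives of
  -- `X` and `Y` cancel against `∇_{[X,Y]} Z`, which leaves an expression in `Γ` alone.
  have hsymm : fderiv ℝ (fderiv ℝ (fieldRep 𝓘(ℝ, E) p Z)) e (fieldRep 𝓘(ℝ, E) p X e)
      (fieldRep 𝓘(ℝ, E) p Y e) = fderiv ℝ (fderiv ℝ (fieldRep 𝓘(ℝ, E) p Z)) e
      (fieldRep 𝓘(ℝ, E) p Y e) (fieldRep 𝓘(ℝ, E) p X e) :=
    (hZ.contDiffAt_fieldRep hp).isSymmSndFDerivAt (by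
      rw [minSmoothness_of_isRCLikeNormedField]
      exact WithTop.coe_le_coe.2 (le_top : (2 : ℕ∞) ≤ ⊤)) _ _
  rw [curvature, map_sub, map_sub, hsecond hX hY, hsecond hY hX,
    toCoord_leviCivita_metric metric hp (hZ.mdifferentiableAt p), hbr, hsymm, hrep, hrep, hrep,
    flatCurvature, ← he, ← hΓdef]
  simp only [lieBracket, map_sub, sub_apply]
  abel

end RiemannianMetric

/-! ### Horizontal and vertical lifts in the charts of the tangent bundle -/

section TangentBundleCoordinates

open Filter Topology VectorField

variable {E : Type*} [NormedAddCommGroup E] [NormedSpace ℝ E]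
  {M : Type*} [TopologicalSpace M] [ChartedSpace E M] [IsManifold 𝓘(ℝ, E) ∞ M]

theorem extChartAt_tangent_apply (z : TangentBundle 𝓘(ℝ, E) M) {y : M}
    (hy : y ∈ (chartAt E z.proj).source) (w : TangentSpace 𝓘(ℝ, E) y) :
    extChartAt 𝓘(ℝ, E).tangent z ⟨y, w⟩
      = (extChartAt 𝓘(ℝ, E) z.proj y, toCoord 𝓘(ℝ, E) z.proj y w) := by
  rw [toCoord_eq_trivialization hy]
  rfl

theorem mem_chartAt_tangent_source (z : TangentBundle 𝓘(ℝ, E) M) {y : M}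
    (hy : y ∈ (chartAt E z.proj).source) (w : TangentSpace 𝓘(ℝ, E) y) :
    (⟨y, w⟩ : TangentBundle 𝓘(ℝ, E) M) ∈ (chartAt (ModelProd E E) z).source :=
  (TangentBundle.mem_chart_source_iff _ _).2 hy

theorem extChartAt_tangent_symm_apply (z : TangentBundle 𝓘(ℝ, E) M) {e : E}
    (he : e ∈ (extChartAt 𝓘(ℝ, E) z.proj).target) (a : E) :
    (extChartAt 𝓘(ℝ, E).tangent z).symm (e, a)
      = ⟨(extChartAt 𝓘(ℝ, E) z.proj).symm e,
          ofCoord 𝓘(ℝ, E) z.proj ((extChartAt 𝓘(ℝ, E) z.proj).symm e) a⟩ := by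
  have hy := extChartAt_symm_mem he
  rw [← extChartAt_symm_extChartAt (I := 𝓘(ℝ, E).tangent) (mem_chartAt_tangent_source z hy
    (ofCoord 𝓘(ℝ, E) z.proj ((extChartAt 𝓘(ℝ, E) z.proj).symm e) a)),
    extChartAt_tangent_apply z hy, toCoord_ofCoord hy, (extChartAt 𝓘(ℝ, E) z.proj).right_inv he]

/-- The lift is defined in the preferred chart at its own base point, so a change of chart is
involved; restricted to a fibre, that change is the linear map `toCoord`, which is its own
derivative. -/
theorem toCoord_verticalLift (z : TangentBundle 𝓘(ℝ, E) M) {y : M}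
    (hy : y ∈ (chartAt E z.proj).source) (w v : TangentSpace 𝓘(ℝ, E) y) :
    toCoord 𝓘(ℝ, E).tangent z ⟨y, w⟩ (verticalLift ⟨y, w⟩ v)
      = (0, toCoord 𝓘(ℝ, E) z.proj y v) := by
  set ζ : TangentBundle 𝓘(ℝ, E) M := ⟨y, w⟩ with hζ
  have hmem := mem_chartAt_tangent_source z hy w
  have hyy : y ∈ (chartAt E ζ.proj).source := mem_chart_source E y
  have h0 : toCoord 𝓘(ℝ, E).tangent z ζ = tangentCoordChange 𝓘(ℝ, E).tangent ζ z ζ :=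
    TangentBundle.continuousLinearMapAt_trivializationAt_eq_core hmem
  have h1 := hasFDerivWithinAt_tangentCoordChange (I := 𝓘(ℝ, E).tangent) (x := ζ) (y := z) (z := ζ)
    ⟨mem_extChartAt_source ζ, by simpa using hy⟩
  rw [ModelWithCorners.range_eq_univ, hasFDerivWithinAt_univ, ← h0,
    extChartAt_tangent_apply ζ hyy] at h1
  have hw : toCoord 𝓘(ℝ, E) ζ.proj y w = w := toCoord_self y w
  rw [hw] at h1
  -- The fibre over `y` in the chart at `ζ`. The derivative of the transition map along it is
  -- computed in two ways and compared by uniqueness.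
  let ℓ : E → E × E := fun b => (extChartAt 𝓘(ℝ, E) y y, b)
  have hℓ : ∀ b : E, HasFDerivAt ℓ (ContinuousLinearMap.inr ℝ E E) b := fun b =>
    hasFDerivAt_prodMk_right _ b
  have h2 := HasFDerivAt.comp (w : E) (f := ℓ) h1 (hℓ w)
  have h3 : ((extChartAt 𝓘(ℝ, E).tangent z) ∘ (extChartAt 𝓘(ℝ, E).tangent ζ).symm) ∘ ℓ
      = fun b : E => (extChartAt 𝓘(ℝ, E) z.proj y, toCoord 𝓘(ℝ, E) z.proj y b) := by
    have key : ∀ b : TangentSpace 𝓘(ℝ, E) y, extChartAt 𝓘(ℝ, E).tangent z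
        ((extChartAt 𝓘(ℝ, E).tangent ζ).symm (ℓ b))
        = (extChartAt 𝓘(ℝ, E) z.proj y, toCoord 𝓘(ℝ, E) z.proj y b) := by
      intro b
      have hb : extChartAt 𝓘(ℝ, E).tangent ζ ⟨y, b⟩ = ℓ b :=
        (extChartAt_tangent_apply ζ hyy b).trans (Prod.ext rfl (toCoord_self y b))
      rw [← hb, extChartAt_symm_extChartAt (mem_chartAt_tangent_source ζ hyy b),
        extChartAt_tangent_apply z hy]
    exact funext key
  rw [h3] at h2
  have h4 : HasFDerivAt (fun b : E => (extChartAt 𝓘(ℝ, E) z.proj y, toCoord 𝓘(ℝ, E) z.proj y b))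
      ((0 : E →L[ℝ] E).prod (toCoord 𝓘(ℝ, E) z.proj y : E →L[ℝ] E)) (w : E) :=
    (hasFDerivAt_const _ _).prodMk (toCoord 𝓘(ℝ, E) z.proj y : E →L[ℝ] E).hasFDerivAt
  exact DFunLike.congr_fun (h2.unique h4) v

theorem toCoord_push (z : TangentBundle 𝓘(ℝ, E) M) {y : M}
    (hy : y ∈ (chartAt E z.proj).source) {s : Π x : M, TangentSpace 𝓘(ℝ, E) x}
    (hs : MDifferentiableAt 𝓘(ℝ, E) 𝓘(ℝ, E).tangent
      (fun x => (⟨x, s x⟩ : TangentBundle 𝓘(ℝ, E) M)) y) (v : TangentSpace 𝓘(ℝ, E) y) :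
    toCoord 𝓘(ℝ, E).tangent z ⟨y, s y⟩ (push s y v)
      = (toCoord 𝓘(ℝ, E) z.proj y v, fderiv ℝ (fieldRep 𝓘(ℝ, E) z.proj s)
          (extChartAt 𝓘(ℝ, E) z.proj y) (toCoord 𝓘(ℝ, E) z.proj y v)) := by
  have hmem := mem_chartAt_tangent_source z hy (s y)
  have hrep := (mdifferentiableAt_iff_fieldRep hy s).1 hs
  have h1 := mfderiv_comp_apply y (g := extChartAt 𝓘(ℝ, E).tangent z)
    (f := fun x => (⟨x, s x⟩ : TangentBundle 𝓘(ℝ, E) M))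
    (mdifferentiableAt_extChartAt hmem) hs v
  rw [← toCoord_eq_mfderiv hmem] at h1
  have h2 : extChartAt 𝓘(ℝ, E).tangent z ∘ (fun x => (⟨x, s x⟩ : TangentBundle 𝓘(ℝ, E) M))
      =ᶠ[𝓝 y] (fun e => (e, fieldRep 𝓘(ℝ, E) z.proj s e)) ∘ extChartAt 𝓘(ℝ, E) z.proj := by
    filter_upwards [(chartAt E z.proj).open_source.mem_nhds hy] with x hx
    simp only [Function.comp_apply]
    rw [extChartAt_tangent_apply z hx, fieldRep_extChartAt hx]
  have h3 : HasFDerivAt (fun e => (e, fieldRep 𝓘(ℝ, E) z.proj s e)) _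
      (extChartAt 𝓘(ℝ, E) z.proj y) := (hasFDerivAt_id _).prodMk hrep.hasFDerivAt
  have h4 := h2.mfderiv_eq (I := 𝓘(ℝ, E)) (I' := 𝓘(ℝ, E × E))
  rw [mfderiv_comp y h3.differentiableAt.mdifferentiableAt (mdifferentiableAt_extChartAt hy),
    ← toCoord_eq_mfderiv hy, mfderiv_eq_fderiv, h3.fderiv] at h4
  exact h1.symm.trans (DFunLike.congr_fun h4 v)

variable [FiniteDimensional ℝ E]
  (metric : ContMDiffRiemannianMetric 𝓘(ℝ, E) ∞ E (fun x : M => TangentSpace 𝓘(ℝ, E) x))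

/-- The differential of a vector field, split into its horizontal and vertical parts. -/
theorem push_eq_lift {y : M} {s : Π x : M, TangentSpace 𝓘(ℝ, E) x}
    (hs : MDifferentiableAt 𝓘(ℝ, E) 𝓘(ℝ, E).tangent
      (fun x => (⟨x, s x⟩ : TangentBundle 𝓘(ℝ, E) M)) y) (v : TangentSpace 𝓘(ℝ, E) y) :
    push s y v = horizontalLift metric.inner ⟨y, s y⟩ v
      + verticalLift ⟨y, s y⟩ (leviCivita 𝓘(ℝ, E) metric.inner s y v) := by
  have hy := mem_chart_source E y
  have h1 := toCoord_push ⟨y, s y⟩ hy hs v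
  rw [toCoord_self] at h1
  have hext := FiberBundle.mdifferentiableAt_extend 𝓘(ℝ, E) E (s y)
  -- The extension used in `christoffel` has constant components near `y`, so its covariant
  -- derivative is the Christoffel term only.
  have hconst : fieldRep 𝓘(ℝ, E) y (FiberBundle.extend E (s y))
      =ᶠ[𝓝 (extChartAt 𝓘(ℝ, E) y y)] fun _ => toCoord 𝓘(ℝ, E) y y (s y) := by
    filter_upwards [extChartAt_target_nhds hy] with e he
    have hmem := extChartAt_symm_mem he
    have : FiberBundle.extend E (s y) ((extChartAt 𝓘(ℝ, E) y).symm e)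
        = ofCoord 𝓘(ℝ, E) y ((extChartAt 𝓘(ℝ, E) y).symm e) (toCoord 𝓘(ℝ, E) y y (s y)) := by
      rw [toCoord_eq_trivialization hy, ofCoord, Trivialization.symmL_apply _ hmem]
      rfl
    rw [fieldRep, this, toCoord_ofCoord hmem]
  have h2 := toCoord_leviCivita_metric metric hy hs v
  have h3 := toCoord_leviCivita_metric metric hy hext v
  rw [FiberBundle.extend_apply_self, hconst.fderiv_eq, fderiv_fun_const, Pi.zero_apply,
    zero_apply, zero_add] at h3
  have h4 : leviCivita 𝓘(ℝ, E) metric.inner s y v - christoffel metric.inner y v (s y)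
      = fderiv ℝ (fieldRep 𝓘(ℝ, E) y s) (extChartAt 𝓘(ℝ, E) y y) (toCoord 𝓘(ℝ, E) y y v) := by
    rw [← toCoord_self y (leviCivita 𝓘(ℝ, E) metric.inner s y v
      - christoffel metric.inner y v (s y)), map_sub, h2, christoffel, h3]
    exact add_sub_cancel_right _ _
  refine h1.trans ?_
  change _ = ((v, -christoffel metric.inner y v (s y)) : E × E)
    + ((0, leviCivita 𝓘(ℝ, E) metric.inner s y v) : E × E)
  refine Prod.ext ?_ ?_
  · exact (toCoord_self y v).trans (add_zero _).symm
  · refine h4.symm.trans ?_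
    exact (sub_eq_neg_add _ _)

/-- Take a section `s` with `s(y) = w`. Then `v^h = s_*(v) - (∇_v s)^v`, and both terms are known in
every chart, so the transformation law of the Christoffel symbols is never needed. -/
theorem toCoord_horizontalLift (z : TangentBundle 𝓘(ℝ, E) M) {y : M}
    (hy : y ∈ (chartAt E z.proj).source) (w v : TangentSpace 𝓘(ℝ, E) y) :
    toCoord 𝓘(ℝ, E).tangent z ⟨y, w⟩ (horizontalLift metric.inner ⟨y, w⟩ v)
      = (toCoord 𝓘(ℝ, E) z.proj y v,
        -flatChristoffel (formRep 𝓘(ℝ, E) z.proj metric.inner) (extChartAt 𝓘(ℝ, E) z.proj y)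
          (toCoord 𝓘(ℝ, E) z.proj y v) (toCoord 𝓘(ℝ, E) z.proj y w)) := by
  obtain ⟨s, hsy, hs⟩ : ∃ s : Π x : M, TangentSpace 𝓘(ℝ, E) x, s y = w ∧
      MDifferentiableAt 𝓘(ℝ, E) 𝓘(ℝ, E).tangent
      (fun x => (⟨x, s x⟩ : TangentBundle 𝓘(ℝ, E) M)) y :=
    ⟨FiberBundle.extend E w, FiberBundle.extend_apply_self E w,
      FiberBundle.mdifferentiableAt_extend 𝓘(ℝ, E) E w⟩
  subst hsy
  have h1 := toCoord_push z hy hs v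
  rw [push_eq_lift metric hs, map_add, toCoord_verticalLift z hy,
    toCoord_leviCivita_metric metric hy hs] at h1
  rw [eq_sub_of_add_eq h1]
  simp

end TangentBundleCoordinates

/-! ### The g-natural metric on E × E and its derivative -/

section FlatNaturalMetric

open Filter Topology

theorem differentiableAt_clm_of_apply {D E F : Type*} [NormedAddCommGroup D] [NormedSpace ℝ D]
    [NormedAddCommGroup E] [NormedSpace ℝ E] [FiniteDimensional ℝ E]
    [NormedAddCommGroup F] [NormedSpace ℝ F] {f : D → E →L[ℝ] F} {x : D}
    (h : ∀ a, DifferentiableAt ℝ (fun y => f y a) x) : DifferentiableAt ℝ f x := by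
  let d := Module.finrank ℝ E
  have hd : d = Module.finrank ℝ (Fin d → ℝ) := (Module.finrank_fin_fun ℝ).symm
  let e₁ := ContinuousLinearEquiv.ofFinrankEq hd
  let e₂ := (e₁.arrowCongr (1 : F ≃L[ℝ] F)).trans (ContinuousLinearEquiv.piRing (Fin d))
  rw [← Function.id_comp f, ← e₂.symm_comp_self]
  exact e₂.symm.differentiableAt.comp x (differentiableAt_pi.2 fun i => h _)

variable {E : Type*} [NormedAddCommGroup E] [NormedSpace ℝ E]

/-- The vertical part of a vector `ξ ∈ E × E` at the point `q` of `E × E`, regarded as the tangent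
bundle of `E` with the metric `h`. -/
def connector (h : E → E →L[ℝ] E →L[ℝ] ℝ) (q ξ : E × E) : E :=
  ξ.2 + flatChristoffel h q.1 ξ.1 q.2

/-- The `g`-natural metric with coefficients `c` on `E × E`, regarded as the tangent bundle of `E`
with the metric `h`. -/
def natForm (c : Coeffs) (h : E → E →L[ℝ] E →L[ℝ] ℝ) (q ξ ζ : E × E) : ℝ :=
  c.A (h q.1 q.2 q.2) * h q.1 ξ.1 ζ.1
    + c.B (h q.1 q.2 q.2) * h q.1 ξ.1 q.2 * h q.1 ζ.1 q.2
    + c.a₂ (h q.1 q.2 q.2) * (h q.1 ξ.1 (connector h q ζ) + h q.1 (connector h q ξ) ζ.1)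
    + c.b₂ (h q.1 q.2 q.2) * (h q.1 ξ.1 q.2 * h q.1 (connector h q ζ) q.2
      + h q.1 (connector h q ξ) q.2 * h q.1 ζ.1 q.2)
    + c.a₁ (h q.1 q.2 q.2) * h q.1 (connector h q ξ) (connector h q ζ)
    + c.b₁ (h q.1 q.2 q.2) * h q.1 (connector h q ξ) q.2 * h q.1 (connector h q ζ) q.2

theorem Coeffs.differentiableWithinAt (c : Coeffs) {t : ℝ} (ht : 0 ≤ t) :
    DifferentiableWithinAt ℝ c.A (Ici 0) t ∧ DifferentiableWithinAt ℝ c.B (Ici 0) t ∧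
    DifferentiableWithinAt ℝ c.a₁ (Ici 0) t ∧ DifferentiableWithinAt ℝ c.a₂ (Ici 0) t ∧
    DifferentiableWithinAt ℝ c.b₁ (Ici 0) t ∧ DifferentiableWithinAt ℝ c.b₂ (Ici 0) t := by
  have key : ∀ {f : ℝ → ℝ}, ContDiffOn ℝ ∞ f (Ici 0) → DifferentiableWithinAt ℝ f (Ici 0) t :=
    fun hf => hf.differentiableOn (by simp) t ht
  exact ⟨(key c.smooth_a₁).add (key c.smooth_a₃), (key c.smooth_b₁).add (key c.smooth_b₃),
    key c.smooth_a₁, key c.smooth_a₂, key c.smooth_b₁, key c.smooth_b₂⟩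

theorem differentiableAt_natForm [CompleteSpace E] (c : Coeffs) {h : E → E →L[ℝ] E →L[ℝ] ℝ}
    (hpos : ∀ e a, 0 ≤ h e a a) {q : E × E} (hh : ContDiffAt ℝ ∞ h q.1)
    (hinv : (h q.1).IsInvertible) (ξ ζ : E × E) :
    DifferentiableAt ℝ (fun q => natForm c h q ξ ζ) q := by
  have hh1 : DifferentiableAt ℝ (fun q : E × E => h q.1) q :=
    DifferentiableAt.comp q (hh.differentiableAt (by simp)) differentiableAt_fst
  have hΓ : DifferentiableAt ℝ (fun q : E × E => flatChristoffel h q.1) q :=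
    DifferentiableAt.comp q ((contDiffAt_flatChristoffel hh hinv).differentiableAt (by simp))
      differentiableAt_fst
  have hw : DifferentiableAt ℝ (fun q : E × E => q.2) q := differentiableAt_snd
  have hK : ∀ ξ : E × E, DifferentiableAt ℝ (fun q => connector h q ξ) q := fun ξ =>
    ((hΓ.clm_apply (differentiableAt_const ξ.1)).clm_apply hw).const_add ξ.2
  have hform : ∀ {a b : E × E → E}, DifferentiableAt ℝ a q → DifferentiableAt ℝ b q →
      DifferentiableAt ℝ (fun q => h q.1 (a q) (b q)) q := fun ha hb =>
    (hh1.clm_apply ha).clm_apply hb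
  have hcoef : ∀ {f : ℝ → ℝ}, DifferentiableWithinAt ℝ f (Ici 0) (h q.1 q.2 q.2) →
      DifferentiableAt ℝ (fun q : E × E => f (h q.1 q.2 q.2)) q := by
    intro f hf
    rw [← differentiableWithinAt_univ]
    exact hf.comp q (hform hw hw).differentiableWithinAt fun q _ => hpos q.1 q.2
  obtain ⟨hA, hB, ha₁, ha₂, hb₁, hb₂⟩ := c.differentiableWithinAt (hpos q.1 q.2)
  have hc : ∀ a : E, DifferentiableAt ℝ (fun _ : E × E => a) q := differentiableAt_const
  unfold natForm
  exact ((((((hcoef hA).mul (hform (hc _) (hc _))).add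
    (((hcoef hB).mul (hform (hc _) hw)).mul (hform (hc _) hw))).add
    ((hcoef ha₂).mul ((hform (hc _) (hK _)).add (hform (hK _) (hc _))))).add
    ((hcoef hb₂).mul (((hform (hc _) hw).mul (hform (hK _) hw)).add
      ((hform (hK _) hw).mul (hform (hc _) hw))))).add
    ((hcoef ha₁).mul (hform (hK _) (hK _)))).add
    (((hcoef hb₁).mul (hform (hK _) hw)).mul (hform (hK _) hw))

/-- Derivative of `h(a, b)` along a curve, in terms of covariant derivatives of `a` and `b`. -/
theorem hasDerivAt_form {h : E → E →L[ℝ] E →L[ℝ] ℝ} {γ a b : ℝ → E} {γ' a' b' : E} {τ : ℝ}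
    (hh : DifferentiableAt ℝ h (γ τ)) (hsymm : ∀ e a b, h e a b = h e b a)
    (hinv : (h (γ τ)).IsInvertible)
    (hγ : HasDerivAt γ γ' τ) (ha : HasDerivAt a a' τ) (hb : HasDerivAt b b' τ) :
    HasDerivAt (fun s => h (γ s) (a s) (b s))
      (h (γ τ) (a' + flatChristoffel h (γ τ) γ' (a τ)) (b τ)
        + h (γ τ) (a τ) (b' + flatChristoffel h (γ τ) γ' (b τ))) τ := by
  have h1 := ((hh.hasFDerivAt.comp_hasDerivAt τ hγ).clm_apply ha).clm_apply hb
  refine h1.congr_deriv ?_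
  simp only [Function.comp_apply, add_apply, map_add,
    fderiv_form_eq hh (Eventually.of_forall hsymm) hinv]
  ring

theorem hasDerivAt_connector {h : E → E →L[ℝ] E →L[ℝ] ℝ} {γ υ : ℝ → E} {γ' υ' : E} {τ : ℝ}
    (hΓ : DifferentiableAt ℝ (flatChristoffel h) (γ τ))
    (hγ : HasDerivAt γ γ' τ) (hυ : HasDerivAt υ υ' τ) (ξ : E × E) :
    HasDerivAt (fun s => connector h (γ s, υ s) ξ)
      (fderiv ℝ (flatChristoffel h) (γ τ) γ' ξ.1 (υ τ) + flatChristoffel h (γ τ) ξ.1 υ') τ := by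
  have h2 := (((hΓ.hasFDerivAt.comp_hasDerivAt τ hγ).clm_apply (hasDerivAt_const τ ξ.1)).clm_apply
    hυ).const_add ξ.2
  refine h2.congr_deriv ?_
  simp only [Function.comp_apply, map_zero, add_zero]

theorem hasDerivAt_comp_dIci {f T : ℝ → ℝ} {T' τ : ℝ} (hT : HasDerivAt T T' τ)
    (hpos : ∀ s, 0 ≤ T s) (hf : DifferentiableWithinAt ℝ f (Ici 0) (T τ)) :
    HasDerivAt (fun s => f (T s)) (dIci f (T τ) * T') τ := by
  rw [← hasDerivWithinAt_univ]
  exact hf.hasDerivWithinAt.comp τ hT.hasDerivWithinAt fun s _ => hpos s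

/-- Derivative of the quadratic form of a `g`-natural metric at a constant vector `ξ` along a
curve in `E × E` whose velocity has horizontal part `w` and vertical part `v`. -/
theorem hasDerivAt_natForm_diag (c : Coeffs) {h : E → E →L[ℝ] E →L[ℝ] ℝ}
    (hpos : ∀ e a, 0 ≤ h e a a) (hsymm : ∀ e a b, h e a b = h e b a) {γ υ : ℝ → E} {τ : ℝ}
    {e u w μ : E} (hγτ : γ τ = e) (hυτ : υ τ = u)
    (hd : DifferentiableAt ℝ h e) (hΓ : DifferentiableAt ℝ (flatChristoffel h) e)
    (hinv : (h e).IsInvertible) (hγ : HasDerivAt γ w τ) (hυ : HasDerivAt υ μ τ)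
    {ξ : E × E} {v x y N K : E} (hx : ξ.1 = x) (hy : connector h (e, u) ξ = y)
    (hv : μ + flatChristoffel h e w u = v) (hN : flatChristoffel h e w x = N)
    (hK : fderiv ℝ (flatChristoffel h) e w x u + flatChristoffel h e x μ
      + flatChristoffel h e w y = K) :
    HasDerivAt (fun s => natForm c h (γ s, υ s) ξ ξ)
      (2 * (dIci c.A (h e u u) * h e u v * h e x x + c.A (h e u u) * h e N x
        + dIci c.B (h e u u) * h e u v * h e u x ^ 2
        + c.B (h e u u) * h e u x * (h e u N + h e v x)
        + 2 * dIci c.a₂ (h e u u) * h e u v * h e x y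
        + c.a₂ (h e u u) * (h e N y + h e x K)
        + 2 * dIci c.b₂ (h e u u) * h e u v * h e u x * h e u y
        + c.b₂ (h e u u) * ((h e u N + h e v x) * h e u y + h e u x * (h e u K + h e v y))
        + dIci c.a₁ (h e u u) * h e u v * h e y y + c.a₁ (h e u u) * h e K y
        + dIci c.b₁ (h e u u) * h e u v * h e u y ^ 2
        + c.b₁ (h e u u) * h e u y * (h e u K + h e v y))) τ := by
  have hform : ∀ {a b : ℝ → E} {a' b' : E}, HasDerivAt a a' τ → HasDerivAt b b' τ →
      HasDerivAt (fun s : ℝ => h (γ s) (a s) (b s))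
        (h e (a' + flatChristoffel h e w (a τ)) (b τ)
          + h e (a τ) (b' + flatChristoffel h e w (b τ))) τ := by
    intro a b a' b' ha hb
    subst hγτ
    exact hasDerivAt_form hd hsymm hinv hγ ha hb
  -- Covariant derivatives along the curve of the ingredients of `natForm`: `v` for the fibre point
  -- `u`, `N` for the constant `x`, and `K` for the vertical part `y` of `ξ`, which varies because
  -- the connector depends on the point.
  have hk := hasDerivAt_connector (h := h) (γ := γ) (υ := υ) (τ := τ) (hγτ.symm ▸ hΓ) hγ hυ ξ
  have hc : HasDerivAt (fun _ : ℝ => x) 0 τ := hasDerivAt_const _ _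
  rw [hγτ, hυτ, hx] at hk
  have hxx := hform hc hc
  have hxu := hform hc hυ
  have hxk := hform hc hk
  have hkx := hform hk hc
  have hku := hform hk hυ
  have hkk := hform hk hk
  have huu := hform hυ hυ
  simp only [hγτ, hυτ, hy, zero_add, hN, hv, hK] at hxx hxu hxk hkx hku hkk huu
  have hcoef : ∀ {f : ℝ → ℝ}, DifferentiableWithinAt ℝ f (Ici 0) (h e u u) →
      HasDerivAt (fun s : ℝ => f (h (γ s) (υ s) (υ s)))
        (dIci f (h e u u) * (h e v u + h e u v)) τ := by
    intro f hf
    have h1 := hasDerivAt_comp_dIci (f := f) huu (fun s => hpos _ _) (by rwa [hγτ, hυτ])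
    rwa [hγτ, hυτ] at h1
  obtain ⟨hA, hB, ha₁, ha₂, hb₁, hb₂⟩ := c.differentiableWithinAt (hpos e u)
  have htotal := (((((((hcoef hA).mul hxx).add (((hcoef hB).mul hxu).mul hxu)).add
    ((hcoef ha₂).mul (hxk.add hkx))).add
    ((hcoef hb₂).mul ((hxu.mul hku).add (hku.mul hxu)))).add
    ((hcoef ha₁).mul hkk)).add (((hcoef hb₁).mul hku).mul hku))
  simp only [natForm, hx]
  refine htotal.congr_deriv ?_
  simp only [Pi.add_apply, Pi.mul_apply, hγτ, hυτ, hy]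
  rw [hsymm e N u, hsymm e x u, hsymm e x v, hsymm e K u, hsymm e y u, hsymm e y v, hsymm e y K,
    hsymm e K x, hsymm e y x, hsymm e x N, hsymm e y N, hsymm e v u]
  ring

/-- Differentiability being known, the derivative can be read off along the straight line with
velocity `(w, μ)`. -/
theorem fderiv_natForm_diag [CompleteSpace E] (c : Coeffs) {h : E → E →L[ℝ] E →L[ℝ] ℝ}
    (hpos : ∀ e a, 0 ≤ h e a a) (hsymm : ∀ e a b, h e a b = h e b a) {e u w μ : E}
    (hh : ContDiffAt ℝ ∞ h e) (hinv : (h e).IsInvertible)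
    {ξ : E × E} {v x y N K : E} (hx : ξ.1 = x) (hy : connector h (e, u) ξ = y)
    (hv : μ + flatChristoffel h e w u = v) (hN : flatChristoffel h e w x = N)
    (hK : fderiv ℝ (flatChristoffel h) e w x u + flatChristoffel h e x μ
      + flatChristoffel h e w y = K) :
    fderiv ℝ (fun q => natForm c h q ξ ξ) (e, u) (w, μ)
      = 2 * (dIci c.A (h e u u) * h e u v * h e x x + c.A (h e u u) * h e N x
        + dIci c.B (h e u u) * h e u v * h e u x ^ 2
        + c.B (h e u u) * h e u x * (h e u N + h e v x)
        + 2 * dIci c.a₂ (h e u u) * h e u v * h e x y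
        + c.a₂ (h e u u) * (h e N y + h e x K)
        + 2 * dIci c.b₂ (h e u u) * h e u v * h e u x * h e u y
        + c.b₂ (h e u u) * ((h e u N + h e v x) * h e u y + h e u x * (h e u K + h e v y))
        + dIci c.a₁ (h e u u) * h e u v * h e y y + c.a₁ (h e u u) * h e K y
        + dIci c.b₁ (h e u u) * h e u v * h e u y ^ 2
        + c.b₁ (h e u u) * h e u y * (h e u K + h e v y)) := by
  have hline : ∀ a b : E, HasDerivAt (fun s : ℝ => a + s • b) b 0 := fun a b => by
    simpa using ((hasDerivAt_id (0 : ℝ)).smul_const b).const_add a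
  have h1 := hasDerivAt_natForm_diag c hpos hsymm (γ := fun s : ℝ => e + s • w)
    (υ := fun s : ℝ => u + s • μ) (τ := 0) (by simp) (by simp) (hh.differentiableAt (by simp))
    ((contDiffAt_flatChristoffel hh hinv).differentiableAt (by simp)) hinv (hline e w) (hline u μ)
    hx hy hv hN hK
  have hq : ((e, u) : E × E) = (e + (0 : ℝ) • w, u + (0 : ℝ) • μ) := by simp
  have h2 := (differentiableAt_natForm c hpos (q := (e, u)) hh hinv ξ ξ).hasFDerivAt
  have h3 := HasFDerivAt.comp_hasDerivAt_of_eq 0 h2 ((hline e w).prodMk (hline u μ)) hq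
  exact h3.unique h1

end FlatNaturalMetric

/-! ### Identification of G with the coordinate model -/

section NaturalMetricInCoordinates

open Filter Topology

variable {E : Type*} [NormedAddCommGroup E] [NormedSpace ℝ E]
  {M : Type*} [TopologicalSpace M] [ChartedSpace E M] [IsManifold 𝓘(ℝ, E) ∞ M]
  (metric : ContMDiffRiemannianMetric 𝓘(ℝ, E) ∞ E (fun x : M => TangentSpace 𝓘(ℝ, E) x))

/-- Positivity is needed for every `e`, also outside the chart target: there the value is still the
metric on some vector at some point of `M`. -/
theorem formRep_metric_nonneg (p : M) (e a : E) :
    0 ≤ formRep 𝓘(ℝ, E) p metric.inner e a a := by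
  set v := ofCoord 𝓘(ℝ, E) p ((extChartAt 𝓘(ℝ, E) p).symm e) a
  change 0 ≤ metric.inner _ v v
  by_cases hv : v = 0
  · rw [hv, map_zero]
  · exact (metric.pos _ v hv).le

theorem eventually_fst_mem_target (z : TangentBundle 𝓘(ℝ, E) M) :
    ∀ᶠ q in 𝓝 (extChartAt 𝓘(ℝ, E).tangent z z), q.1 ∈ (extChartAt 𝓘(ℝ, E) z.proj).target :=
  (continuous_fst.tendsto (extChartAt 𝓘(ℝ, E).tangent z z)).eventually
    (extChartAt_target_mem_nhds (I := 𝓘(ℝ, E)) z.proj)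

variable [FiniteDimensional ℝ E]

/-- Splitting a coordinate vector into horizontal and vertical parts is what allows the defining
equations of a `g`-natural metric to be applied to it. -/
theorem ofCoord_tangent (z : TangentBundle 𝓘(ℝ, E) M) {y : M}
    (hy : y ∈ (chartAt E z.proj).source) (w : TangentSpace 𝓘(ℝ, E) y) (ξ : E × E) :
    ofCoord 𝓘(ℝ, E).tangent z ⟨y, w⟩ ξ
      = horizontalLift metric.inner ⟨y, w⟩ (ofCoord 𝓘(ℝ, E) z.proj y ξ.1)
        + verticalLift ⟨y, w⟩ (ofCoord 𝓘(ℝ, E) z.proj y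
          (connector (formRep 𝓘(ℝ, E) z.proj metric.inner)
            (extChartAt 𝓘(ℝ, E) z.proj y, toCoord 𝓘(ℝ, E) z.proj y w) ξ)) := by
  have hmem := mem_chartAt_tangent_source z hy w
  apply toCoord_injective hmem
  rw [toCoord_ofCoord hmem, map_add, toCoord_horizontalLift metric z hy, toCoord_verticalLift z hy,
    toCoord_ofCoord hy, toCoord_ofCoord hy, connector]
  ext <;> simp

variable {metric} {c : Coeffs}
  {G : Π z : TangentBundle 𝓘(ℝ, E) M, TangentSpace 𝓘(ℝ, E).tangent z →L[ℝ]
      TangentSpace 𝓘(ℝ, E).tangent z →L[ℝ] ℝ}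

theorem formRep_tangent_extChartAt (hG : IsGNatural metric.inner c G)
    (z : TangentBundle 𝓘(ℝ, E) M) {y : M}
    (hy : y ∈ (chartAt E z.proj).source) (w : TangentSpace 𝓘(ℝ, E) y) (ξ ζ : E × E) :
    formRep 𝓘(ℝ, E).tangent z G
        (extChartAt 𝓘(ℝ, E) z.proj y, toCoord 𝓘(ℝ, E) z.proj y w) ξ ζ
      = natForm c (formRep 𝓘(ℝ, E) z.proj metric.inner)
        (extChartAt 𝓘(ℝ, E) z.proj y, toCoord 𝓘(ℝ, E) z.proj y w) ξ ζ := by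
  have hmem := mem_chartAt_tangent_source z hy w
  rw [← extChartAt_tangent_apply z hy w, formRep_extChartAt hmem, ofCoord_tangent metric z hy,
    ofCoord_tangent metric z hy, extChartAt_tangent_apply z hy w]
  simp only [map_add, add_apply, hG.hor_hor, hG.hor_ver, hG.ver_hor, hG.ver_ver, natForm,
    formRep_extChartAt hy, ofCoord_toCoord hy]
  ring

theorem formRep_tangent_eq (hG : IsGNatural metric.inner c G)
    (z : TangentBundle 𝓘(ℝ, E) M) {q : E × E} (hq : q.1 ∈ (extChartAt 𝓘(ℝ, E) z.proj).target)
    (ξ ζ : E × E) :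
    formRep 𝓘(ℝ, E).tangent z G q ξ ζ
      = natForm c (formRep 𝓘(ℝ, E) z.proj metric.inner) q ξ ζ := by
  have hy := extChartAt_symm_mem hq
  have h1 := formRep_tangent_extChartAt hG z hy
    (ofCoord 𝓘(ℝ, E) z.proj ((extChartAt 𝓘(ℝ, E) z.proj).symm q.1) q.2) ξ ζ
  rwa [toCoord_ofCoord hy, (extChartAt 𝓘(ℝ, E) z.proj).right_inv hq] at h1

theorem IsGNatural.symm (hG : IsGNatural metric.inner c G) (z : TangentBundle 𝓘(ℝ, E) M)
    (ξ ζ : TangentSpace 𝓘(ℝ, E).tangent z) : G z ξ ζ = G z ζ ξ := by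
  have hz := mem_chart_source (ModelProd E E) z
  rw [← formRep_toCoord hz, ← formRep_toCoord hz]
  have hmem : (extChartAt 𝓘(ℝ, E).tangent z z).1 ∈ (extChartAt 𝓘(ℝ, E) z.proj).target :=
    mem_extChartAt_target z.proj
  rw [formRep_tangent_eq hG z hmem, formRep_tangent_eq hG z hmem]
  have hs := formRep_symm (I := 𝓘(ℝ, E)) metric.symm z.proj (extChartAt 𝓘(ℝ, E).tangent z z).1
  simp only [natForm]
  rw [hs (toCoord 𝓘(ℝ, E).tangent z z ζ).1 (toCoord 𝓘(ℝ, E).tangent z z ξ).1,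
    hs (toCoord 𝓘(ℝ, E).tangent z z ζ).1
      (connector _ (extChartAt 𝓘(ℝ, E).tangent z z) (toCoord 𝓘(ℝ, E).tangent z z ξ)),
    hs (connector _ (extChartAt 𝓘(ℝ, E).tangent z z) (toCoord 𝓘(ℝ, E).tangent z z ζ))
      (toCoord 𝓘(ℝ, E).tangent z z ξ).1,
    hs (connector _ (extChartAt 𝓘(ℝ, E).tangent z z) (toCoord 𝓘(ℝ, E).tangent z z ζ))
      (connector _ (extChartAt 𝓘(ℝ, E).tangent z z) (toCoord 𝓘(ℝ, E).tangent z z ξ))]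
  ring

theorem formRep_tangent_apply_eventuallyEq (hG : IsGNatural metric.inner c G)
    (z : TangentBundle 𝓘(ℝ, E) M) (ξ ζ : E × E) :
    (fun q => formRep 𝓘(ℝ, E).tangent z G q ξ ζ) =ᶠ[𝓝 (extChartAt 𝓘(ℝ, E).tangent z z)]
      fun q => natForm c (formRep 𝓘(ℝ, E) z.proj metric.inner) q ξ ζ :=
  (eventually_fst_mem_target z).mono fun _ hq => formRep_tangent_eq hG z hq ξ ζ

/-- Regularity of `G` is not part of the data: it follows from that of `g` and of the coefficients
through `natForm`. One derivative is all that the Koszul formula asks for. -/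
theorem differentiableAt_formRep_tangent (hG : IsGNatural metric.inner c G)
    (z : TangentBundle 𝓘(ℝ, E) M) :
    DifferentiableAt ℝ (formRep 𝓘(ℝ, E).tangent z G) (extChartAt 𝓘(ℝ, E).tangent z z) := by
  have : CompleteSpace E := FiniteDimensional.complete ℝ E
  refine differentiableAt_clm_of_apply fun ξ => differentiableAt_clm_of_apply fun ζ => ?_
  rw [(formRep_tangent_apply_eventuallyEq hG z ξ ζ).differentiableAt_iff]
  exact differentiableAt_natForm c (formRep_metric_nonneg metric z.proj)
    (contDiffAt_formRep_metric metric (mem_chart_source E z.proj))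
    (isInvertible_formRep_metric metric (mem_extChartAt_target z.proj)) ξ ζ

theorem fieldRep_liftField (W V : Π x : M, TangentSpace 𝓘(ℝ, E) x)
    (z : TangentBundle 𝓘(ℝ, E) M) {q : E × E}
    (hq : q.1 ∈ (extChartAt 𝓘(ℝ, E) z.proj).target) :
    fieldRep 𝓘(ℝ, E).tangent z (liftField metric.inner W V) q
      = (fieldRep 𝓘(ℝ, E) z.proj W q.1,
        fieldRep 𝓘(ℝ, E) z.proj V q.1
          - flatChristoffel (formRep 𝓘(ℝ, E) z.proj metric.inner) q.1
            (fieldRep 𝓘(ℝ, E) z.proj W q.1) q.2) := by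
  have hy := extChartAt_symm_mem hq
  rw [fieldRep, extChartAt_tangent_symm_apply z hq, liftField, map_add,
    toCoord_horizontalLift metric z hy, toCoord_verticalLift z hy, toCoord_ofCoord hy,
    (extChartAt 𝓘(ℝ, E) z.proj).right_inv hq]
  ext
  · simp [fieldRep]
  · simp [fieldRep, sub_eq_neg_add]

/-- Product rule for `(W, V - Γ(W, u))`, where the fields depend on the base variable only and the
fibre variable enters linearly. -/
theorem hasFDerivAt_fieldRep_liftField {W V : Π x : M, TangentSpace 𝓘(ℝ, E) x}
    (hW : SmoothField W) (hV : SmoothField V) (z : TangentBundle 𝓘(ℝ, E) M) {e : E}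
    (he : extChartAt 𝓘(ℝ, E) z.proj z.proj = e) (u : E) :
    DifferentiableAt ℝ (fieldRep 𝓘(ℝ, E).tangent z (liftField metric.inner W V)) (e, u) ∧
    ∀ a b : E, fderiv ℝ (fieldRep 𝓘(ℝ, E).tangent z (liftField metric.inner W V)) (e, u) (a, b)
      = (fderiv ℝ (fieldRep 𝓘(ℝ, E) z.proj W) e a,
        fderiv ℝ (fieldRep 𝓘(ℝ, E) z.proj V) e a
        - (fderiv ℝ (flatChristoffel (formRep 𝓘(ℝ, E) z.proj metric.inner)) e a
            (fieldRep 𝓘(ℝ, E) z.proj W e) u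
          + flatChristoffel (formRep 𝓘(ℝ, E) z.proj metric.inner) e
            (fderiv ℝ (fieldRep 𝓘(ℝ, E) z.proj W) e a) u
          + flatChristoffel (formRep 𝓘(ℝ, E) z.proj metric.inner) e
            (fieldRep 𝓘(ℝ, E) z.proj W e) b)) := by
  have hp := mem_chart_source E z.proj
  have hev : fieldRep 𝓘(ℝ, E).tangent z (liftField metric.inner W V) =ᶠ[𝓝 (e, u)] fun q =>
      (fieldRep 𝓘(ℝ, E) z.proj W q.1, fieldRep 𝓘(ℝ, E) z.proj V q.1
        - flatChristoffel (formRep 𝓘(ℝ, E) z.proj metric.inner) q.1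
          (fieldRep 𝓘(ℝ, E) z.proj W q.1) q.2) := by
    have h1 : ∀ᶠ q in 𝓝 ((e, u) : E × E), q.1 ∈ (extChartAt 𝓘(ℝ, E) z.proj).target := by
      subst he
      exact (continuous_fst.tendsto _).eventually
        (extChartAt_target_mem_nhds (I := 𝓘(ℝ, E)) z.proj)
    exact h1.mono fun q hq => fieldRep_liftField W V z hq
  have hWd : HasFDerivAt (fieldRep 𝓘(ℝ, E) z.proj W)
      (fderiv ℝ (fieldRep 𝓘(ℝ, E) z.proj W) e) ((e, u) : E × E).1 := by
    subst he
    exact ((hW.contDiffAt_fieldRep hp).differentiableAt (by simp)).hasFDerivAt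
  have hVd : HasFDerivAt (fieldRep 𝓘(ℝ, E) z.proj V)
      (fderiv ℝ (fieldRep 𝓘(ℝ, E) z.proj V) e) ((e, u) : E × E).1 := by
    subst he
    exact ((hV.contDiffAt_fieldRep hp).differentiableAt (by simp)).hasFDerivAt
  have hΓd : HasFDerivAt (flatChristoffel (formRep 𝓘(ℝ, E) z.proj metric.inner))
      (fderiv ℝ (flatChristoffel (formRep 𝓘(ℝ, E) z.proj metric.inner)) e) ((e, u) : E × E).1 := by
    subst he
    exact ((contDiffAt_flatChristoffel_metric metric hp).differentiableAt (by simp)).hasFDerivAt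
  have hW1 := hWd.comp (e, u) hasFDerivAt_fst
  have hV1 := hVd.comp (e, u) hasFDerivAt_fst
  have hΓ1 := hΓd.comp (e, u) hasFDerivAt_fst
  have htot := hW1.prodMk (hV1.fun_sub ((hΓ1.clm_apply hW1).clm_apply hasFDerivAt_snd))
  have htot' := htot.congr_of_eventuallyEq hev
  refine ⟨htot'.differentiableAt, fun a b => ?_⟩
  rw [htot'.fderiv]
  ext
  · simp
  · simp
    abel

end NaturalMetricInCoordinates

/-! ### The diagonal of the second fundamental form -/

section SecondFundamentalForm

open Filter Topology

/-- `h(∇_v Y, v) = h(D_v Y, v) + ½ (D_Y h)(v, v)` in coordinates. -/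
theorem form_leviCivita_self {E : Type*} [NormedAddCommGroup E] [NormedSpace ℝ E]
    [FiniteDimensional ℝ E] {H : Type*} [TopologicalSpace H] {I : ModelWithCorners ℝ E H}
    [I.Boundaryless] {N : Type*} [TopologicalSpace N] [ChartedSpace H N] [IsManifold I ∞ N]
    {h : Π x : N, TangentSpace I x →L[ℝ] TangentSpace I x →L[ℝ] ℝ}
    {p y : N} (hy : y ∈ (chartAt H p).source)
    (hh : DifferentiableAt ℝ (formRep I p h) (extChartAt I p y))
    (hsymm : ∀ x v w, h x v w = h x w v)
    (hnd : ∀ v : TangentSpace I y, (∀ w, h y v w = 0) → v = 0)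
    {Y : Π x : N, TangentSpace I x}
    (hY : MDifferentiableAt I I.tangent (fun x => (⟨x, Y x⟩ : TangentBundle I N)) y)
    (v : TangentSpace I y) :
    h y (leviCivita I h Y y v) v
      = formRep I p h (extChartAt I p y)
          (fderiv ℝ (fieldRep I p Y) (extChartAt I p y) (toCoord I p y v)) (toCoord I p y v)
        + 1 / 2 * fderiv ℝ (fun e => formRep I p h e (toCoord I p y v) (toCoord I p y v))
          (extChartAt I p y) (toCoord I p y (Y y)) := by
  -- In `½ (∂_v h(Y,v) + ∂_Y h(v,v) - ∂_v h(v,Y))` the outer terms cancel by symmetry.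
  rw [← formRep_toCoord hy, toCoord_leviCivita hy hh hsymm hnd hY, map_add, add_apply,
    form_flatChristoffel (isInvertible_formRep hy hnd),
    fderiv_form_symm hh (Eventually.of_forall (formRep_symm hsymm p)) (toCoord I p y v)
      (toCoord I p y v) (toCoord I p y (Y y))]
  have h1 := (hh.hasFDerivAt.clm_apply (hasFDerivAt_const (toCoord I p y v) _)).clm_apply
    (hasFDerivAt_const (toCoord I p y v) _)
  rw [h1.fderiv]
  simp

/-- The second fundamental form of a section of the tangent bundle of a chart domain, with respect
to a `g`-natural metric. -/
theorem natForm_add_half_fderiv {E : Type*} [NormedAddCommGroup E] [NormedSpace ℝ E]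
    [CompleteSpace E] (c : Coeffs) {h : E → E →L[ℝ] E →L[ℝ] ℝ}
    (hpos : ∀ e a, 0 ≤ h e a a) (hsymm : ∀ e a b, h e a b = h e b a) {e : E}
    (hh : ContDiffAt ℝ ∞ h e) (hinv : ∀ᶠ e' in 𝓝 e, (h e').IsInvertible)
    {u x y w v du dw dv xw xv : E} (hy : du + flatChristoffel h e x u = y)
    (hxw : dw + flatChristoffel h e x w = xw) (hxv : dv + flatChristoffel h e x v = xv) :
    natForm c h (e, u) (dw, dv - (fderiv ℝ (flatChristoffel h) e x w u
        + flatChristoffel h e dw u + flatChristoffel h e w du)) (x, du)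
      + 1 / 2 * fderiv ℝ (fun q => natForm c h q (x, du) (x, du)) (e, u)
        (w, v - flatChristoffel h e w u)
    = c.a₁ (h e u u) * h e (flatCurvature h e u y w) x
        + c.a₂ (h e u u) * h e (flatCurvature h e u x w) x
        + c.A (h e u u) * h e x xw + c.B (h e u u) * h e u x * h e u xw
        + c.B (h e u u) * h e u x * h e v x
        + c.a₁ (h e u u) * h e y xv + c.b₁ (h e u u) * h e u y * h e v y
        + c.b₁ (h e u u) * h e u y * h e u xv
        + c.a₂ (h e u u) * h e x xv + c.a₂ (h e u u) * h e y xw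
        + c.b₂ (h e u u) * h e u x * h e u xv + c.b₂ (h e u u) * h e u x * h e v y
        + c.b₂ (h e u u) * h e u y * h e v x
        + c.b₂ (h e u u) * h e u y * h e u xw
        + dIci c.A (h e u u) * h e u v * h e x x
        + dIci c.B (h e u u) * h e u v * h e u x ^ 2
        + dIci c.a₁ (h e u u) * h e u v * h e y y
        + 2 * dIci c.a₂ (h e u u) * h e u v * h e x y
        + dIci c.b₁ (h e u u) * h e u v * h e u y ^ 2
        + 2 * dIci c.b₂ (h e u u) * h e u v * h e u x * h e u y := by
  have hs : ∀ᶠ e' in 𝓝 e, ∀ a b, h e' a b = h e' b a := Eventually.of_forall hsymm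
  set Γ := flatChristoffel h with hΓ
  set ρ := flatCurvature h e x w u with hρ
  obtain ⟨N, hN⟩ : ∃ N, Γ e w x = N := ⟨_, rfl⟩
  obtain ⟨K, hK⟩ : ∃ K, fderiv ℝ Γ e w x u + Γ e x (v - Γ e w u) + Γ e w y = K := ⟨_, rfl⟩
  have hdw : dw = xw - N := by
    rw [← hxw, ← hN, hΓ, flatChristoffel_symm (hh.differentiableAt (by simp)) hs
      hinv.self_of_nhds w x]
    abel
  -- The vertical part of `D_ξ η`. The mismatch between the derivatives of `Γ` in the directions `x`
  -- and `w` is the curvature `ρ = R(x,w)u`; the rest of the correction is exactly the `K` that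
  -- occurs in the derivative of the metric.
  have hcon : connector h (e, u) (dw, dv - (fderiv ℝ Γ e x w u + Γ e dw u + Γ e w du))
      = xv - ρ - K := by
    simp only [connector, hρ, flatCurvature, ← hΓ, ← hK, ← hxv, ← hy, map_add, map_sub]
    abel
  have hcy : connector h (e, u) (x, du) = y := hy
  -- Skew-symmetry in the last two slots. It removes every curvature term with coefficient `b₁` or
  -- `b₂`.
  have hρu : h e ρ u = 0 := by
    have := flatCurvature_skew hh hs hinv x w u u
    linarith
  have hρ' : ∀ b, h e ρ b = -h e (flatCurvature h e u b w) x := fun b => by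
    rw [hρ, flatCurvature_pair_symm hh hs hinv, flatCurvature_skew hh hs hinv]
  rw [fderiv_natForm_diag c hpos hsymm hh hinv.self_of_nhds (x := x) rfl hcy
    (sub_add_cancel v (Γ e w u)) hN hK]
  simp only [natForm, hcon, hcy]
  simp only [hdw, map_sub, sub_apply, hρu]
  simp only [hρ']
  rw [hsymm e xv x, hsymm e xw x, hsymm e xw u, hsymm e xv u, hsymm e xv y, hsymm e xw y,
    hsymm e K x, hsymm e N u, hsymm e K u, hsymm e x u, hsymm e y u]
  ring

variable {E : Type*} [NormedAddCommGroup E] [NormedSpace ℝ E] [FiniteDimensional ℝ E]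
  {M : Type*} [TopologicalSpace M] [ChartedSpace E M] [IsManifold 𝓘(ℝ, E) ∞ M]
  {metric : ContMDiffRiemannianMetric 𝓘(ℝ, E) ∞ E (fun x : M => TangentSpace 𝓘(ℝ, E) x)}
  {c : Coeffs}
  {G : Π z : TangentBundle 𝓘(ℝ, E) M, TangentSpace 𝓘(ℝ, E).tangent z →L[ℝ]
      TangentSpace 𝓘(ℝ, E).tangent z →L[ℝ] ℝ}

/-- Bridge from the manifold to the model: `form_leviCivita_self` in the chart of `TM` at `(p,
u(p))`, with `G`, the lifted field and `u_*(s)` replaced by their coordinate expressions. -/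
theorem IsGNatural.leviCivita_liftField_push (hG : IsGNatural metric.inner c G)
    (hGnd : Nondegenerate G) {u W V : Π x : M, TangentSpace 𝓘(ℝ, E) x}
    (hu : SmoothField u) (hW : SmoothField W) (hV : SmoothField V) (p : M)
    (s : TangentSpace 𝓘(ℝ, E) p) {e û x : E} (he : extChartAt 𝓘(ℝ, E) p p = e)
    (hû : toCoord 𝓘(ℝ, E) p p (u p) = û) (hx : toCoord 𝓘(ℝ, E) p p s = x) :
    G ⟨p, u p⟩ (leviCivita 𝓘(ℝ, E).tangent G (liftField metric.inner W V) ⟨p, u p⟩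
        (push u p s)) (push u p s)
      = natForm c (formRep 𝓘(ℝ, E) p metric.inner) (e, û)
          (fderiv ℝ (fieldRep 𝓘(ℝ, E) p W) e x, fderiv ℝ (fieldRep 𝓘(ℝ, E) p V) e x
            - (fderiv ℝ (flatChristoffel (formRep 𝓘(ℝ, E) p metric.inner)) e x
                (toCoord 𝓘(ℝ, E) p p (W p)) û
              + flatChristoffel (formRep 𝓘(ℝ, E) p metric.inner) e
                (fderiv ℝ (fieldRep 𝓘(ℝ, E) p W) e x) û
              + flatChristoffel (formRep 𝓘(ℝ, E) p metric.inner) e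
                (toCoord 𝓘(ℝ, E) p p (W p)) (fderiv ℝ (fieldRep 𝓘(ℝ, E) p u) e x)))
          (x, fderiv ℝ (fieldRep 𝓘(ℝ, E) p u) e x)
        + 1 / 2 * fderiv ℝ (fun q => natForm c (formRep 𝓘(ℝ, E) p metric.inner) q
            (x, fderiv ℝ (fieldRep 𝓘(ℝ, E) p u) e x) (x, fderiv ℝ (fieldRep 𝓘(ℝ, E) p u) e x))
          (e, û) (toCoord 𝓘(ℝ, E) p p (W p), toCoord 𝓘(ℝ, E) p p (V p)
            - flatChristoffel (formRep 𝓘(ℝ, E) p metric.inner) e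
              (toCoord 𝓘(ℝ, E) p p (W p)) û) := by
  have hp := mem_chart_source E p
  let z : TangentBundle 𝓘(ℝ, E) M := ⟨p, u p⟩
  have hz := mem_chart_source (ModelProd E E) z
  have hφz : extChartAt 𝓘(ℝ, E).tangent z z = (e, û) := by
    rw [← he, ← hû]
    exact extChartAt_tangent_apply z hp (u p)
  have hmem : ((e, û) : E × E).1 ∈ (extChartAt 𝓘(ℝ, E) z.proj).target := by
    rw [← he]
    exact mem_extChartAt_target p
  obtain ⟨hηd, hη'⟩ := hasFDerivAt_fieldRep_liftField (metric := metric) hW hV z he û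
  have hηm : MDifferentiableAt 𝓘(ℝ, E).tangent 𝓘(ℝ, E).tangent.tangent
      (fun ζ => (⟨ζ, liftField metric.inner W V ζ⟩ :
        TangentBundle 𝓘(ℝ, E).tangent (TangentBundle 𝓘(ℝ, E) M))) z := by
    rw [mdifferentiableAt_iff_fieldRep hz, hφz]
    exact hηd
  have hpush := toCoord_push z hp (hu.mdifferentiableAt p) s
  have hη : toCoord 𝓘(ℝ, E).tangent z z (liftField metric.inner W V z)
      = (toCoord 𝓘(ℝ, E) p p (W p), toCoord 𝓘(ℝ, E) p p (V p)
            - flatChristoffel (formRep 𝓘(ℝ, E) p metric.inner) e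
              (toCoord 𝓘(ℝ, E) p p (W p)) û) := by
    rw [← fieldRep_extChartAt hz, hφz, fieldRep_liftField W V z hmem, ← he]
    simp only [z, fieldRep_extChartAt hp]
  have hWe : fieldRep 𝓘(ℝ, E) p W e = toCoord 𝓘(ℝ, E) p p (W p) := by
    rw [← he, fieldRep_extChartAt hp]
  have hmain := form_leviCivita_self hz (differentiableAt_formRep_tangent hG z) hG.symm (hGnd z)
    hηm (push u p s)
  refine hmain.trans ?_
  have hev := formRep_tangent_apply_eventuallyEq hG z
    (toCoord 𝓘(ℝ, E).tangent z z (push u p s)) (toCoord 𝓘(ℝ, E).tangent z z (push u p s))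
  rw [hev.fderiv_eq, hη, hφz, formRep_tangent_eq hG z hmem]
  have hpush' : toCoord 𝓘(ℝ, E).tangent z z (push u p s)
      = (x, fderiv ℝ (fieldRep 𝓘(ℝ, E) p u) e x) := by
    rw [← hx, ← he]
    exact hpush
  rw [hpush', hη']
  simp only [z, hWe]

theorem IsGNatural.leviCivita_liftField_push_eq (hG : IsGNatural metric.inner c G)
    (hGnd : Nondegenerate G) {u X W V : Π x : M, TangentSpace 𝓘(ℝ, E) x}
    (hu : SmoothField u) (hX : SmoothField X) (hW : SmoothField W) (hV : SmoothField V) (p : M) :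
    let g := metric.inner p
    let nab := leviCivita 𝓘(ℝ, E) metric.inner
    let R := fun Y₁ Y₂ Y₃ Y₄ : (Π x : M, TangentSpace 𝓘(ℝ, E) x) =>
      g (curvature 𝓘(ℝ, E) metric.inner Y₁ Y₂ Y₃ p) (Y₄ p)
    let Xu := fun x : M => nab u x (X x)
    let XW := nab W p (X p)
    let XV := nab V p (X p)
    let U := u p
    let x := X p
    let y := Xu p
    let v := V p
    let t := g U U
    let z : TangentBundle 𝓘(ℝ, E) M := ⟨p, u p⟩
    let η := liftField metric.inner W V
    let uX := push u p (X p)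
    G z (leviCivita 𝓘(ℝ, E).tangent G η z uX) uX
      = c.a₁ t * R u Xu W X + c.a₂ t * R u X W X
        + c.A t * g x XW + c.B t * g U x * g U XW + c.B t * g U x * g v x
        + c.a₁ t * g y XV + c.b₁ t * g U y * g v y + c.b₁ t * g U y * g U XV
        + c.a₂ t * g x XV + c.a₂ t * g y XW
        + c.b₂ t * g U x * g U XV + c.b₂ t * g U x * g v y + c.b₂ t * g U y * g v x
        + c.b₂ t * g U y * g U XW
        + dIci c.A t * g U v * g x x
        + dIci c.B t * g U v * g U x ^ 2
        + dIci c.a₁ t * g U v * g y y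
        + 2 * dIci c.a₂ t * g U v * g x y
        + dIci c.b₁ t * g U v * g U y ^ 2
        + 2 * dIci c.b₂ t * g U v * g U x * g U y := by
  have : CompleteSpace E := FiniteDimensional.complete ℝ E
  intro g nab R Xu XW XV U x y v t z η uX
  have hp := mem_chart_source E p
  have hinv : ∀ᶠ e' in 𝓝 (extChartAt 𝓘(ℝ, E) p p),
      (formRep 𝓘(ℝ, E) p metric.inner e').IsInvertible :=
    mem_of_superset (extChartAt_target_mem_nhds (I := 𝓘(ℝ, E)) p)
      fun _ he => isInvertible_formRep_metric metric he
  have hnab : ∀ {Y : Π x : M, TangentSpace 𝓘(ℝ, E) x}, SmoothField Y → _ := fun {Y} hY =>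
    (toCoord_leviCivita_metric metric hp (hY.mdifferentiableAt p) (X p)).symm
  -- `curvature` takes vector fields, so `∇_X u` must be a smooth field and not only a vector at
  -- `p`.
  have hXu : SmoothField Xu := hX.leviCivita metric hu
  have hflat := natForm_add_half_fderiv c (formRep_metric_nonneg metric p)
    (formRep_symm metric.symm p) (contDiffAt_formRep_metric metric hp) hinv
    (hnab hu) (hnab hW) (hnab hV)
  have hmain := hG.leviCivita_liftField_push hGnd hu hW hV p (X p) rfl rfl rfl
  refine hmain.trans (hflat.trans ?_)
  have hR₁ := toCoord_curvature metric hu hXu hW p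
  have hR₂ := toCoord_curvature metric hu hX hW p
  rw [← hR₂]
  erw [← hR₁]
  simp only [formRep_toCoord hp]
  rfl

end SecondFundamentalForm

/-! ### The Weingarten decomposition -/

section ShapeOperator

variable {E : Type*} [NormedAddCommGroup E] [NormedSpace ℝ E] [FiniteDimensional ℝ E]
  {M : Type*} [TopologicalSpace M] [ChartedSpace E M] [IsManifold 𝓘(ℝ, E) ∞ M]
  {G : Π z : TangentBundle 𝓘(ℝ, E) M, TangentSpace 𝓘(ℝ, E).tangent z →L[ℝ]
      TangentSpace 𝓘(ℝ, E).tangent z →L[ℝ] ℝ}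

/-- A bilinear form that is non-degenerate on the range of `f` admits orthogonal projections onto
that range. -/
theorem exists_projection_range {V₁ V₂ : Type*} [AddCommGroup V₁] [Module ℝ V₁]
    [FiniteDimensional ℝ V₁] [AddCommGroup V₂] [Module ℝ V₂] (B : V₂ →ₗ[ℝ] V₂ →ₗ[ℝ] ℝ)
    (f : V₁ →ₗ[ℝ] V₂) (hB : ∀ s, (∀ v, B (f s) (f v) = 0) → f s = 0) (w : V₂) :
    ∃ s, ∀ v, B (w - f s) (f v) = 0 := by
  let T : LinearMap.range f →ₗ[ℝ] Module.Dual ℝ (LinearMap.range f) :=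
    B.domRestrict₁₂ (LinearMap.range f) (LinearMap.range f)
  have hT : Function.Injective T := by
    refine (injective_iff_map_eq_zero T).2 ?_
    rintro ⟨_, s, rfl⟩ hs
    exact Subtype.ext (hB s fun v => DFunLike.congr_fun hs ⟨f v, v, rfl⟩)
  obtain ⟨⟨_, s, rfl⟩, hs⟩ :=
    (LinearMap.injective_iff_surjective_of_finrank_eq_finrank
      (Subspace.dual_finrank_eq (K := ℝ) (V := LinearMap.range f)).symm).1 hT
      ((B w).domRestrict (LinearMap.range f))
  refine ⟨s, fun v => ?_⟩
  have h1 : B (f s) (f v) = B w (f v) := DFunLike.congr_fun hs ⟨f v, v, rfl⟩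
  rw [map_sub, LinearMap.sub_apply, h1, sub_self]

/-- Pairing `∇̃η = -S + D` with a tangent vector kills `D`. Any `S` admitted by the decomposition
gives the same pairing, so existence is enough for the vector chosen by `Classical.epsilon`. -/
theorem InducedNondegenerateAt.neg_shapeOperator {u : Π x : M, TangentSpace 𝓘(ℝ, E) x} {p : M}
    (hnd : InducedNondegenerateAt G u p)
    (η : Π z : TangentBundle 𝓘(ℝ, E) M, TangentSpace 𝓘(ℝ, E).tangent z)
    (s t : TangentSpace 𝓘(ℝ, E) p) :
    -(G ⟨p, u p⟩ (shapeOperator G u η p s) (push u p t))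
      = G ⟨p, u p⟩ (leviCivita 𝓘(ℝ, E).tangent G η ⟨p, u p⟩ (push u p s)) (push u p t) := by
  have : FiniteDimensional ℝ (TangentSpace 𝓘(ℝ, E) p) := inferInstanceAs (FiniteDimensional ℝ E)
  let z : TangentBundle 𝓘(ℝ, E) M := ⟨p, u p⟩
  set w := leviCivita 𝓘(ℝ, E).tangent G η ⟨p, u p⟩ (push u p s) with hw
  obtain ⟨r, hr⟩ := exists_projection_range (G z).toLinearMap₁₂ (push u p).toLinearMap hnd w
  have hex : ∃ S, (∃ s : TangentSpace 𝓘(ℝ, E) p, push u p s = S) ∧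
      ∃ D : TangentSpace 𝓘(ℝ, E).tangent (⟨p, u p⟩ : TangentBundle 𝓘(ℝ, E) M),
        IsNormal G u p D ∧
        leviCivita 𝓘(ℝ, E).tangent G η ⟨p, u p⟩ (push u p s) = -S + D := by
    -- The tangential projection of `w` is `u_*(r)`, and the Weingarten sign makes `S = u_*(-r)`.
    refine ⟨push u p (-r), ⟨-r, rfl⟩, w - push u p r, hr, ?_⟩
    rw [map_neg, neg_neg, add_sub_cancel]
  obtain ⟨-, D, hD, hdec⟩ := Classical.epsilon_spec hex
  change w = -shapeOperator G u η p s + D at hdec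
  rw [hdec, map_add, add_apply, hD t, add_zero, map_neg, neg_apply]

end ShapeOperator

end GNatural

end

theorem mainTheorem1
    {E : Type*} [NormedAddCommGroup E] [NormedSpace ℝ E] [FiniteDimensional ℝ E]
    {M : Type*} [TopologicalSpace M] [T2Space M] [ChartedSpace E M]
    [IsManifold 𝓘(ℝ, E) ∞ M]
    (metric : ContMDiffRiemannianMetric 𝓘(ℝ, E) ∞ E
      (fun x : M => TangentSpace 𝓘(ℝ, E) x))
    (c : GNatural.Coeffs)
    (G : Π z : TangentBundle 𝓘(ℝ, E) M, TangentSpace 𝓘(ℝ, E).tangent z →L[ℝ]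
      TangentSpace 𝓘(ℝ, E).tangent z →L[ℝ] ℝ)
    (hG : GNatural.IsGNatural metric.inner c G)
    (hGnd : GNatural.Nondegenerate G)
    (u X W V : Π x : M, TangentSpace 𝓘(ℝ, E) x)
    (hu : GNatural.SmoothField u) (hX : GNatural.SmoothField X)
    (hW : GNatural.SmoothField W) (hV : GNatural.SmoothField V)
    (hnormal : ∀ q : M,
      GNatural.IsNormal G u q (GNatural.liftField metric.inner W V ⟨q, u q⟩))
    (p : M) :
    let g := metric.inner p
    let nab := GNatural.leviCivita 𝓘(ℝ, E) metric.inner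
    let R := fun Y₁ Y₂ Y₃ Y₄ : (Π x : M, TangentSpace 𝓘(ℝ, E) x) =>
      g (GNatural.curvature 𝓘(ℝ, E) metric.inner Y₁ Y₂ Y₃ p) (Y₄ p)
    let Xu := fun x : M => nab u x (X x)
    let XW := nab W p (X p)
    let XV := nab V p (X p)
    let U := u p
    let x := X p
    let y := Xu p
    let v := V p
    let t := g U U
    let z : TangentBundle 𝓘(ℝ, E) M := ⟨p, u p⟩
    let η := GNatural.liftField metric.inner W V
    let uX := GNatural.push u p (X p)
    (GNatural.InducedNondegenerateAt G u p →
      -(G z (GNatural.shapeOperator G u η p (X p)) uX)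
        = G z (GNatural.leviCivita 𝓘(ℝ, E).tangent G η z uX) uX) ∧
    G z (GNatural.leviCivita 𝓘(ℝ, E).tangent G η z uX) uX
      = c.a₁ t * R u Xu W X + c.a₂ t * R u X W X
        + c.A t * g x XW + c.B t * g U x * g U XW + c.B t * g U x * g v x
        + c.a₁ t * g y XV + c.b₁ t * g U y * g v y + c.b₁ t * g U y * g U XV
        + c.a₂ t * g x XV + c.a₂ t * g y XW
        + c.b₂ t * g U x * g U XV + c.b₂ t * g U x * g v y + c.b₂ t * g U y * g v x
        + c.b₂ t * g U y * g U XW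
        + GNatural.dIci c.A t * g U v * g x x
        + GNatural.dIci c.B t * g U v * g U x ^ 2
        + GNatural.dIci c.a₁ t * g U v * g y y
        + 2 * GNatural.dIci c.a₂ t * g U v * g x y
        + GNatural.dIci c.b₁ t * g U v * g U y ^ 2
        + 2 * GNatural.dIci c.b₂ t * g U v * g U x * g U y := by
  exact ⟨fun hnd => hnd.neg_shapeOperator _ _ _,
    hG.leviCivita_liftField_push_eq hGnd hu hX hW hV p⟩
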